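/- Let $q>2$ be a prime power with $q\not\equiv 1\pmod 3$. Let $\phi\in \mathrm{P\Gamma L}(3,q^3)$ be a collineation of $\mathrm{PG}(2,q^3)$ of order $3$ that fixes pointwise an $\mathbb{F}_q$-plane (a subplane $\mathrm{PG}(2,q)$). A point has Type II if its orbit under $\phi$ is three distinct collinear points, and Type III if its orbit is three non-collinear points; a line has Type III if its orbit is three non-concurrent lines. View the underlying space $\mathbb{F}_{q^3}^3$ as a $9$-dimensional space over $\mathbb{F}_q$: a point $\bar P$ of $\mathrm{PG}(2,q^3)$ becomes a plane $[\![P]\!]$ of $\mathrm{PG}(8,q)$ (these planes form a Desarguesian spread), and a line $\bar\ell$ becomes a $5$-space $[\![\ell]\!]$. For a set $\mathcal K$ of points of $\mathrm{PG}(8,q)$ let $\mathbf B(\mathcal K)$ be the set of points $\bar P$ with $\mathcal K\cap[\![P]\!]\neq\emptyset$. Then $\phi$ is induced by a projectivity $\sigma\in\mathrm{PGL}(9,q)$, that is, $[\![P]\!]^\sigma=[\![P^\phi]\!]$ for all $\bar P$. Let $\sigma$ be any such projectivity. There is a unique plane $\pi_{\mathrm{fix}}$ of $\mathrm{PG}(8,q)$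 fixed pointwise by $\sigma$. A II$_:$-point is a point $X$ of $\mathrm{PG}(8,q)$ that lies in $[\![P]\!]$ for some Type-II-point $\bar P$ and for which $X,X^\sigma,X^{\sigma^2}$ are collinear. A fixed-III-plane is a plane fixed by $\sigma$ that contains a point $X$ which lies in $[\![P]\!]$ for some Type-III-point $\bar P$ and for which $X,X^\sigma,X^{\sigma^2}$ form a triangle. A normal rational $3$-fold scroll is a set of $q+1$ planes in one system of ruling planes of a Segre variety $\mathcal S_{2;2}$ that meet each plane of the other system in the points of a non-degenerate conic. For a Type-III-point $\bar G$ let $\bar m_G$ be the line joining $\bar G^{\phi}$ and $\bar G^{\phi^2}$, let $\bar{\mathcal E}_G$ be the set of Type-II-points on $\bar m_G$, let $\bar{\mathcal F}_G=\{\bar\ell^{\phi}\cap\bar\ell^{\phi^2} : \bar\ell \text{ a Type-III-line through } \bar G\}$, and let $\{\!|\bar G|\!\}=\bar{\mathcal E}_G\cup\bar{\mathcal F}_G$ be the Figueroa block of $\bar G$. **Theorem.** Let $\bar G$ be a Type-III-point and $\gamma=[\![G]\!]$. 1. The set $\mathbb G$ of fixed-III-planes meeting $\gamma$ is one system of ruling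 planes of a Segre variety $\mathcal S_{2;2}$; denote the other system, which is determined by $\mathbb G$, by $\mathbb G'$. Let $P\in\gamma$ and $\pi=\langle P,P^\sigma,P^{\sigma^2}\rangle$. Then $\pi\in\mathbb G$, and $\pi$ contains a unique fixed point $A$ of $\sigma$. There is a unique non-degenerate conic $\mathcal C$ in $\pi$ that contains $A,P^\sigma,P^{\sigma^2}$ and has the tangents $PP^\sigma$ and $PP^{\sigma^2}$. The set $\mathcal D$ of planes of $\mathbb G'$ that meet $\mathcal C$ consists of $q+1$ planes and is a normal rational $3$-fold scroll, and $\mathbf B(\mathcal D\setminus\pi_{\mathrm{fix}})=\bar{\mathcal F}_G$. 2. The set of all II$_:$-points in the $5$-space $[\![m_G]\!]$ is the set of points of a plane $\beta\in\mathbb G'$, and $\mathbf B(\beta)=\bar{\mathcal E}_G$. 3. $\{\!|\bar G|\!\}=\mathbf B\bigl(\beta\cup(\mathcal D\setminus\pi_{\mathrm{fix}})\bigr)$, and for each point $\bar Q\in\{\!|\bar G|\!\}$ other than $\bar G^\phi$ and $\bar G^{\phi^2}$, the plane $[\![Q]\!]$ contains exactly one point of $\beta\cup(\mathcal D\setminus\pi_{\mathrm{fix}})$.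 (Here a set of planes is also regarded as the set of points that they cover.) -/

import Mathlib

open scoped LinearAlgebra.Projectivization

namespace Figueroa

/- Throughout, `K` plays the role of the field with `q` elements, `L` that of its cubic extension,
and `V` is a three-dimensional vector space over `L`. So `ℙ L V` is `PG(2,q^3)`, and `ℙ K V` is
`PG(8,q)`. A subspace of projective dimension `d` is a `Submodule` of `finrank` `d + 1`, and a point
`X` lies on a subspace `W` when `X.submodule ≤ W`. -/

section General

variable {F V : Type*} [Field F] [AddCommGroup V] [Module F V]

/-- The set of points of a subspace. -/
def pts (W : Submodule F V) : Set (ℙ F V) := {X | X.submodule ≤ W}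

/-- Three points lie on a common line. -/
def Collinear3 (X Y Z : ℙ F V) : Prop :=
  ∃ ℓ : Submodule F V, Module.finrank F ℓ = 2 ∧ X ∈ pts ℓ ∧ Y ∈ pts ℓ ∧ Z ∈ pts ℓ

/-- Lines, as sets of points. -/
def IsLine (m : Set (ℙ F V)) : Prop :=
  ∃ ℓ : Submodule F V, Module.finrank F ℓ = 2 ∧ m = pts ℓ

/-- The projectivity induced by a linear bijection, acting on points. -/
def act (s : V ≃ₗ[F] V) (X : ℙ F V) : ℙ F V :=
  Projectivization.map s.toLinearMap s.injective X

/-- `C` is a non-degenerate conic of the plane `π`: the zero set in `π` of a quadratic form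
having no singular point in `π`. -/
def IsNondegConic (π : Submodule F V) (C : Set (ℙ F V)) : Prop :=
  ∃ Q : QuadraticForm F V,
    (∀ v ∈ π, Q v = 0 → (∀ w ∈ π, QuadraticMap.polar Q v w = 0) → v = 0) ∧
    C = {X | X ∈ pts π ∧ ∀ v ∈ X.submodule, Q v = 0}

/-- A line is tangent to a non-degenerate conic if they have exactly one common point. -/
def IsTangent (C : Set (ℙ F V)) (ℓ : Submodule F V) : Prop :=
  ∃! X, X ∈ C ∧ X ∈ pts ℓ

/-- `R` and `R'` are the two systems of ruling planes of a Segre variety `S_{2;2}`: in suitable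
coordinates the variety consists of the points `(u_i w_j)`, the planes of `R` are obtained by fixing
`u`, and those of `R'` by fixing `w`. -/
def AreSegreRulings (R R' : Set (Submodule F V)) : Prop :=
  ∃ e : Matrix (Fin 3) (Fin 3) F ≃ₗ[F] V,
    R = {W : Submodule F V | ∃ u : Fin 3 → F, u ≠ 0 ∧
      (W : Set V) = Set.range fun w : Fin 3 → F => e (Matrix.vecMulVec u w)} ∧
    R' = {W : Submodule F V | ∃ w : Fin 3 → F, w ≠ 0 ∧
      (W : Set V) = Set.range fun u : Fin 3 → F => e (Matrix.vecMulVec u w)}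

/-- The points covered by a set of subspaces. -/
def cover (D : Set (Submodule F V)) : Set (ℙ F V) := {X | ∃ W ∈ D, X ∈ pts W}

/-- A normal rational 3-fold scroll: `q + 1` planes of one system of ruling planes of a Segre variety
`S_{2;2}` that cut out a non-degenerate conic in every plane of the other system. -/
def IsNormalRationalScroll (D : Set (Submodule F V)) : Prop :=
  ∃ R R' : Set (Submodule F V), AreSegreRulings R R' ∧ D ⊆ R' ∧
    D.ncard = Nat.card F + 1 ∧ ∀ π ∈ R, IsNondegConic π (cover D ∩ pts π)

end General

section Plane

variable {L V : Type*} [Field L] [AddCommGroup V] [Module L V]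

/-- `φ` is an element of `PΓL`: it is induced by a semilinear bijection. -/
def IsCollineation (φ : Equiv.Perm (ℙ L V)) : Prop :=
  ∃ (τ : L ≃+* L) (f : V ≃+ V), (∀ (c : L) (v : V), f (c • v) = τ c • f v) ∧
    ∀ (P : ℙ L V) (v : V), v ∈ P.submodule → f v ∈ (φ P).submodule

/-- `S` is an `F_q`-plane: up to a change of basis, the points with coordinates in `K`. -/
def IsFqPlane (K : Type*) [Field K] [Module K V] (S : Set (ℙ L V)) : Prop :=
  ∃ b : Module.Basis (Fin 3) L V,
    S = {P | ∃ c : Fin 3 → K, c ≠ 0 ∧ ∑ i, c i • b i ∈ P.submodule}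

/-- The orbit of the point consists of three distinct collinear points (for `φ` of order 3). -/
def TypeII (φ : Equiv.Perm (ℙ L V)) (P : ℙ L V) : Prop :=
  φ P ≠ P ∧ Collinear3 P (φ P) (φ (φ P))

/-- The orbit of the point consists of three non-collinear points. -/
def TypeIII (φ : Equiv.Perm (ℙ L V)) (P : ℙ L V) : Prop :=
  ¬ Collinear3 P (φ P) (φ (φ P))

/-- The orbit of the line consists of three non-concurrent lines. -/
def LineTypeIII (φ : Equiv.Perm (ℙ L V)) (ℓ : Set (ℙ L V)) : Prop :=
  IsLine ℓ ∧ ¬ ∃ P, P ∈ ℓ ∧ P ∈ φ '' ℓ ∧ P ∈ φ '' (φ '' ℓ)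

/-- The line `m_G` joining `G^φ` and `G^(φ^2)`. -/
def mLine (φ : Equiv.Perm (ℙ L V)) (G : ℙ L V) : Submodule L V :=
  (φ G).submodule ⊔ (φ (φ G)).submodule

/-- `E_G`: the Type-II-points on `m_G`. -/
def setE (φ : Equiv.Perm (ℙ L V)) (G : ℙ L V) : Set (ℙ L V) :=
  {P | P ∈ pts (mLine φ G) ∧ TypeII φ P}

/-- `F_G`: the points `ℓ^φ ∩ ℓ^(φ^2)`, for `ℓ` a Type-III-line through `G`. -/
def setF (φ : Equiv.Perm (ℙ L V)) (G : ℙ L V) : Set (ℙ L V) :=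
  {P | ∃ ℓ : Set (ℙ L V), LineTypeIII φ ℓ ∧ G ∈ ℓ ∧ φ '' ℓ ∩ φ '' (φ '' ℓ) = {P}}

/-- The Figueroa block of `G`. -/
def figBlock (φ : Equiv.Perm (ℙ L V)) (G : ℙ L V) : Set (ℙ L V) :=
  setE φ G ∪ setF φ G

end Plane

section Bose

variable {K L V : Type*} [Field K] [Field L] [Algebra K L] [AddCommGroup V] [Module K V]
  [Module L V] [IsScalarTower K L V]

/-- Field reduction of a subspace of `PG(2,q^3)`: a point gives a plane of the Desarguesian spread
of `PG(8,q)`, and a line gives a 5-space. -/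
def bose (K : Type*) {L V : Type*} [Field K] [Field L] [Algebra K L] [AddCommGroup V] [Module K V]
    [Module L V] [IsScalarTower K L V] (W : Submodule L V) : Submodule K V :=
  W.restrictScalars K

/-- The points of `PG(2,q^3)` whose spread plane meets the point set `T` of `PG(8,q)`. -/
def B (L : Type*) {K V : Type*} [Field K] [Field L] [Algebra K L] [AddCommGroup V] [Module K V]
    [Module L V] [IsScalarTower K L V] (T : Set (ℙ K V)) : Set (ℙ L V) :=
  {P | (T ∩ pts (bose K P.submodule)).Nonempty}

/-- The projectivity `σ` of `PG(8,q)` given by `s` induces `φ` on the spread planes. -/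
def Induces (s : V ≃ₗ[K] V) (φ : Equiv.Perm (ℙ L V)) : Prop :=
  ∀ P : ℙ L V, (bose K P.submodule).map s.toLinearMap = bose K (φ P).submodule

/-- `X` is a point of a Type II spread plane such that `X, X^σ, X^(σ^2)` are collinear. -/
def IsIIColon (φ : Equiv.Perm (ℙ L V)) (s : V ≃ₗ[K] V) (X : ℙ K V) : Prop :=
  (∃ P : ℙ L V, TypeII φ P ∧ X ∈ pts (bose K P.submodule)) ∧
    Collinear3 X (act s X) (act s (act s X))

/-- `X` is a point of a Type III spread plane such that `X, X^σ, X^(σ^2)` form a triangle. -/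
def IsIIITriangle (φ : Equiv.Perm (ℙ L V)) (s : V ≃ₗ[K] V) (X : ℙ K V) : Prop :=
  (∃ P : ℙ L V, TypeIII φ P ∧ X ∈ pts (bose K P.submodule)) ∧
    ¬ Collinear3 X (act s X) (act s (act s X))

/-- A fixed-III-plane: a plane fixed by `σ` that contains a point of the preceding kind. -/
def IsFixedIIIPlane (φ : Equiv.Perm (ℙ L V)) (s : V ≃ₗ[K] V) (π : Submodule K V) : Prop :=
  Module.finrank K π = 3 ∧ π.map s.toLinearMap = π ∧ ∃ X ∈ pts π, IsIIITriangle φ s X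

/-- The set of fixed-III-planes meeting the spread plane of `G`. -/
def setG (φ : Equiv.Perm (ℙ L V)) (s : V ≃ₗ[K] V) (G : ℙ L V) : Set (Submodule K V) :=
  {π | IsFixedIIIPlane φ s π ∧ (pts π ∩ pts (bose K G.submodule)).Nonempty}

/-- A plane all of whose points are fixed by `σ`. -/
def IsPtwiseFixedPlane (s : V ≃ₗ[K] V) (π : Submodule K V) : Prop :=
  Module.finrank K π = 3 ∧ ∀ X ∈ pts π, act s X = X

/-- The plane `⟨P, P^σ, P^(σ^2)⟩`. -/
def orbitSpan (s : V ≃ₗ[K] V) (P : ℙ K V) : Submodule K V :=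
  P.submodule ⊔ (act s P).submodule ⊔ (act s (act s P)).submodule

/-- `C` is a non-degenerate conic in `⟨P, P^σ, P^(σ^2)⟩` that contains `A, P^σ, P^(σ^2)` and has the
tangents `P P^σ` and `P P^(σ^2)`. -/
def IsSpecifiedConic (s : V ≃ₗ[K] V) (P A : ℙ K V) (C : Set (ℙ K V)) : Prop :=
  IsNondegConic (orbitSpan s P) C ∧ A ∈ C ∧ act s P ∈ C ∧ act s (act s P) ∈ C ∧
    IsTangent C (P.submodule ⊔ (act s P).submodule) ∧
    IsTangent C (P.submodule ⊔ (act s (act s P)).submodule)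

/-- The planes of the system `R'` that meet the point set `C`. -/
def planesMeeting (R' : Set (Submodule K V)) (C : Set (ℙ K V)) : Set (Submodule K V) :=
  {W | W ∈ R' ∧ (C ∩ pts W).Nonempty}

end Bose

end Figueroa

/-! Good coordinates turn everything into a computation with triples over `K`. Since φ fixes an
F_q-plane pointwise, a scalar multiple of its semilinear map applies a nontrivial automorphism τ of
`L / K` to each coordinate (`exists_semilinear`). Any `s` inducing φ differs from this map by a
scalar μ of `L`. The norm of μ is a cube in `K`, because cubing is bijective on `K` when q is not 1
mod 3, so a `K`-multiple of `s` is τ-semilinear of order 3 (`exists_cube_eq_one`). If G = ⟨v⟩ has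
Type III, then v, s v, s² v is a basis on which `s` acts as (x, y, z) ↦ (z^τ, x^τ, y^τ)
(`exists_frame`). Write `seg w x` for (w₀x, w₁x^τ, w₂x^(τ²)). These vectors are the pure tensors of
K³ ⊗ L ≅ V, and `s` rotates w and fixes x. Fixing x gives the planes of 𝔾, fixing w those of 𝔾'. The
point P has w = (1,0,0), the fixed plane w = (1,1,1), the conic is w₀² = w₁w₂, and β has w =
(0,1,-1). It remains to compare with the block, where N is the norm of `L / K`. A point (0, y, z) of
m_G has Type II iff N(y) + N(z) = 0, and Hilbert 90 makes it a multiple of some `seg (0,1,-1) x`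
(`setE_eq`). A line my + nz = 0 through G has Type III iff N(m) + N(n) ≠ 0. Its two images meet in a
multiple of some `seg w x` with w on the conic, and the norm condition says that w is not
proportional to (1,1,1) (`setF_eq`). Finally, two such vectors with w₁, w₂ nonzero that are
proportional over `L` are proportional over `K`, since 1 is the only cube root of unity in `K`
(`exists_smul_seg_eq`). -/

namespace Figueroa

/-- What is used of a generator `τ` of the Galois group of a cubic extension `L / K` of finite
fields for which cubing is a bijection of `K`. -/
structure IsCubicTwist {K L : Type*} [Field K] [Field L] [Algebra K L] (τ : L ≃ₐ[K] L) : Prop where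
  cube : ∀ x, τ (τ (τ x)) = x
  fixed : ∀ x, τ x = x → ∃ k : K, algebraMap K L k = x
  hilbert : ∀ z, z * τ z * τ (τ z) = 1 → ∃ y, y ≠ 0 ∧ τ y = z * y
  cube_bij : Function.Bijective fun k : K => k ^ 3

/-! ### Cubic extensions: cubes, fixed field, Hilbert 90. -/

section

variable {K L : Type*} [Field K] [Field L] [Algebra K L]

/-- The unit group has order q - 1, which is prime to 3. -/
theorem cube_bijective [Finite K] (hq : ¬ Nat.card K ≡ 1 [MOD 3]) :
    Function.Bijective fun k : K => k ^ 3 := by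
  have hpos : 0 < Nat.card K := Nat.card_pos
  have hcop : (Nat.card Kˣ).Coprime 3 := by
    rw [Nat.card_units, Nat.coprime_comm, Nat.Prime.coprime_iff_not_dvd Nat.prime_three]
    intro h
    exact hq ((Nat.modEq_iff_dvd' hpos).2 h).symm
  have hinj : Function.Injective fun k : K => k ^ 3 := by
    intro a b hab
    simp only at hab
    by_cases ha : a = 0
    · subst ha
      exact (by simpa using hab.symm : b = 0).symm
    by_cases hb : b = 0
    · subst hb
      simpa using hab
    have := (powCoprime hcop).injective (a₁ := Units.mk0 a ha) (a₂ := Units.mk0 b hb)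
      (by simpa [Units.ext_iff] using hab)
    simpa [Units.ext_iff] using this
  exact ⟨hinj, Finite.injective_iff_surjective.1 hinj⟩

/-- The degree 3 is prime, so the fixed field of τ is `K` or `L`, and `L` would force τ = 1. -/
theorem fixed_of_ne_one (hL : Module.finrank K L = 3) {τ : L ≃ₐ[K] L} (hτ : τ ≠ 1) (x : L)
    (hx : τ x = x) : ∃ k : K, algebraMap K L k = x := by
  have hfd : FiniteDimensional K L := Module.finite_of_finrank_pos (by omega)
  let E := IntermediateField.fixedField (Subgroup.zpowers τ)
  have hmul := Module.finrank_mul_finrank K E L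
  rw [hL] at hmul
  have hxE : x ∈ E := by
    rw [IntermediateField.mem_fixedField_iff]
    rintro f ⟨n, rfl⟩
    have : τ ∈ MulAction.stabilizer (L ≃ₐ[K] L) x := hx
    exact Subgroup.zpow_mem _ this n
  have hE : E = ⊥ := by
    rw [← IntermediateField.finrank_eq_one_iff]
    have hd : Module.finrank K E ∣ 3 := ⟨_, hmul.symm⟩
    rcases (Nat.dvd_prime Nat.prime_three).1 hd with h | h
    · exact h
    exfalso
    have h1 : Module.finrank E L = 1 := by rw [h] at hmul; omega
    have htop : E = ⊤ := IntermediateField.finrank_eq_one_iff_eq_top.1 h1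
    apply hτ
    ext y
    have : y ∈ E := htop ▸ IntermediateField.mem_top
    rw [IntermediateField.mem_fixedField_iff] at this
    exact this τ (Subgroup.mem_zpowers τ)
  rw [hE, IntermediateField.mem_bot] at hxE
  exact hxE

theorem cube_of_finrank [Finite K] (hL : Module.finrank K L = 3) (τ : L ≃ₐ[K] L) (x : L) :
    τ (τ (τ x)) = x := by
  have hfd : FiniteDimensional K L := Module.finite_of_finrank_pos (by omega)
  have hfin : Finite L := Module.finite_of_finite K
  have hcard := IsGalois.card_aut_eq_finrank K L
  rw [hL] at hcard
  have := pow_card_eq_one' (x := τ)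
  rw [hcard] at this
  exact DFunLike.congr_fun this x

/-- The classical resolvent: independence of the characters 1, τ, τ² supplies a u at which the sum
does not vanish, and that sum is the required y. -/
theorem hilbert_ninety {τ : L ≃ₐ[K] L} (hτ : τ ≠ 1) (h3 : ∀ x, τ (τ (τ x)) = x) (z : L)
    (hz : z * τ z * τ (τ z) = 1) : ∃ y, y ≠ 0 ∧ τ y = z * y := by
  have hz0 : z ≠ 0 := by rintro rfl; simp at hz
  have hz1 : τ z ≠ 0 := by simpa using hz0
  have hz2 : τ (τ z) ≠ 0 := by simpa using hz0
  let m : Fin 3 → (L →* L) := ![MonoidHom.id L, (τ : L →* L), ((τ * τ : L ≃ₐ[K] L) : L →* L)]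
  have hinj : Function.Injective m := by
    have h01 : m 0 ≠ m 1 := fun h => hτ (by ext x; exact (DFunLike.congr_fun h x).symm)
    have h02 : m 0 ≠ m 2 := fun h => hτ (by
      ext x
      have := DFunLike.congr_fun h (τ x)
      simpa [m, h3] using this)
    have h12 : m 1 ≠ m 2 := fun h => hτ (by
      ext x
      have := DFunLike.congr_fun h x
      exact (τ.injective (by simpa [m] using this)).symm)
    intro i j hij
    fin_cases i <;> fin_cases j <;> first | rfl | exact absurd hij (by assumption) |
      exact absurd hij.symm (by assumption)
  have hli := (linearIndependent_monoidHom L L).comp m hinj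
  rw [Fintype.linearIndependent_iff] at hli
  obtain ⟨u, hu⟩ : ∃ u : L, u + z⁻¹ * τ u + z⁻¹ * (τ z)⁻¹ * τ (τ u) ≠ 0 := by
    by_contra! hc
    have := hli ![1, z⁻¹, z⁻¹ * (τ z)⁻¹] (by
      ext u
      have := hc u
      simpa [Fin.sum_univ_three, m] using this) 0
    simp at this
  refine ⟨_, hu, ?_⟩
  simp only [map_add, map_mul, map_inv₀, h3]
  -- The norm condition turns the last coefficient of τ y into z, so the three terms of z y reappear
  -- cyclically shifted.
  have e : (τ z)⁻¹ * (τ (τ z))⁻¹ = z := by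
    field_simp
    linear_combination -hz
  rw [e]
  field_simp
  ring

theorem isCubicTwist_of_ne_one [Finite K] (hL : Module.finrank K L = 3)
    (hq : ¬ Nat.card K ≡ 1 [MOD 3]) {τ : L ≃ₐ[K] L} (hτ : τ ≠ 1) : IsCubicTwist τ where
  cube := cube_of_finrank hL τ
  fixed := fixed_of_ne_one hL hτ
  hilbert := hilbert_ninety hτ (cube_of_finrank hL τ)
  cube_bij := cube_bijective hq

end

/-! ### Points and lines in vectors; a ruling system determines its opposite. -/

section

variable {F V : Type*} [Field F] [AddCommGroup V] [Module F V]

theorem mk_mem_pts {v : V} {hv : v ≠ 0} {W : Submodule F V} :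
    Projectivization.mk F v hv ∈ pts W ↔ v ∈ W := by
  simp [pts, Projectivization.submodule_mk]

theorem act_mk (s : V ≃ₗ[F] V) {v : V} (hv : v ≠ 0) :
    act s (Projectivization.mk F v hv) =
      Projectivization.mk F (s v) (by simpa using hv) := rfl

theorem exists_mk (P : ℙ F V) : ∃ v, ∃ hv : v ≠ 0, P = Projectivization.mk F v hv :=
  ⟨P.rep, P.rep_nonzero, P.mk_rep.symm⟩

theorem eq_mk_of_mem {P : ℙ F V} {v : V} (hv : v ≠ 0) (h : v ∈ P.submodule) :
    P = Projectivization.mk F v hv := by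
  obtain ⟨u, hu, rfl⟩ := exists_mk P
  rw [Projectivization.submodule_mk, Submodule.mem_span_singleton] at h
  obtain ⟨a, rfl⟩ := h
  symm
  rw [Projectivization.mk_eq_mk_iff']
  exact ⟨a, rfl⟩

theorem submodule_eq_span {P : ℙ F V} {v : V} (hv : v ≠ 0) (h : v ∈ P.submodule) :
    P.submodule = Submodule.span F {v} := by
  rw [eq_mk_of_mem hv h, Projectivization.submodule_mk]

theorem finrank_ker_of_ne_zero (hV : Module.finrank F V = 3) {f : Module.Dual F V} (hf : f ≠ 0) :
    Module.finrank F (LinearMap.ker f) = 2 := by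
  have hfd : FiniteDimensional F V := Module.finite_of_finrank_pos (by omega)
  have := Module.Dual.finrank_ker_add_one_of_ne_zero hf
  omega

theorem exists_eq_ker (hV : Module.finrank F V = 3) {ℓ : Submodule F V}
    (h : Module.finrank F ℓ = 2) : ∃ f : Module.Dual F V, f ≠ 0 ∧ ℓ = LinearMap.ker f := by
  have hfd : FiniteDimensional F V := Module.finite_of_finrank_pos (by omega)
  have hlt : ℓ < ⊤ := by
    rw [lt_top_iff_ne_top]
    rintro rfl
    rw [finrank_top] at h
    omega
  obtain ⟨f, hf, hle⟩ := Submodule.exists_le_ker_of_lt_top ℓ hlt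
  refine ⟨f, hf, Submodule.eq_of_le_of_finrank_eq hle ?_⟩
  rw [h, finrank_ker_of_ne_zero hV hf]

theorem collinear3_mk_iff (hV : Module.finrank F V = 3) {u v w : V} (hu : u ≠ 0) (hv : v ≠ 0)
    (hw : w ≠ 0) :
    Collinear3 (Projectivization.mk F u hu) (Projectivization.mk F v hv)
      (Projectivization.mk F w hw) ↔
      ∃ f : Module.Dual F V, f ≠ 0 ∧ f u = 0 ∧ f v = 0 ∧ f w = 0 := by
  constructor
  · rintro ⟨ℓ, h2, h⟩
    simp only [mk_mem_pts] at h
    obtain ⟨f, hf, rfl⟩ := exists_eq_ker hV h2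
    exact ⟨f, hf, by simpa using h⟩
  · rintro ⟨f, hf, h⟩
    refine ⟨LinearMap.ker f, finrank_ker_of_ne_zero hV hf, ?_⟩
    simpa only [mk_mem_pts, LinearMap.mem_ker] using h

theorem isLine_iff (hV : Module.finrank F V = 3) {m : Set (ℙ F V)} :
    IsLine m ↔ ∃ f : Module.Dual F V, f ≠ 0 ∧ m = pts (LinearMap.ker f) := by
  constructor
  · rintro ⟨ℓ, h2, rfl⟩
    obtain ⟨f, hf, rfl⟩ := exists_eq_ker hV h2
    exact ⟨f, hf, rfl⟩
  · rintro ⟨f, hf, rfl⟩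
    exact ⟨_, finrank_ker_of_ne_zero hV hf, rfl⟩

/-- If two tensors `u₁ ⊗ w₁` and `u₂ ⊗ w₂` and their sum `x ⊗ y` are pure, then the left factors or
the right factors of the two are proportional. -/
theorem exists_smul_of_vecMulVec_add {u₁ u₂ x w₁ w₂ y : Fin 3 → F} (hu₁ : u₁ ≠ 0)
    (hw₁ : w₁ ≠ 0)
    (h : Matrix.vecMulVec u₁ w₁ + Matrix.vecMulVec u₂ w₂ = Matrix.vecMulVec x y) :
    (∃ c : F, u₂ = c • u₁) ∨ ∃ c : F, w₂ = c • w₁ := by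
  have hij : ∀ i j, u₁ i * w₁ j + u₂ i * w₂ j = x i * y j := fun i j => by
    simpa [Matrix.vecMulVec_apply] using congrFun (congrFun h i) j
  obtain ⟨i, hi⟩ := Function.ne_iff.1 hu₁
  obtain ⟨j, hj⟩ := Function.ne_iff.1 hw₁
  simp only [Pi.zero_apply] at hi hj
  -- By Cauchy–Binet this product is a 2×2 minor of the sum, which has rank at most one.
  have key : ∀ k l, (u₁ i * u₂ k - u₁ k * u₂ i) * (w₁ j * w₂ l - w₁ l * w₂ j) = 0 := by
    intro k l
    linear_combination (u₁ k * w₁ l + u₂ k * w₂ l) * hij i j + x i * y j * hij k l -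
      (u₁ k * w₁ j + u₂ k * w₂ j) * hij i l - x i * y l * hij k j
  by_cases hc : ∀ k, u₁ i * u₂ k - u₁ k * u₂ i = 0
  · left
    refine ⟨u₂ i / u₁ i, funext fun k => ?_⟩
    simp only [Pi.smul_apply, smul_eq_mul]
    field_simp
    linear_combination hc k
  · right
    push Not at hc
    obtain ⟨k, hk⟩ := hc
    refine ⟨w₂ j / w₁ j, funext fun l => ?_⟩
    have := (mul_eq_zero.1 (key k l)).resolve_left hk
    simp only [Pi.smul_apply, smul_eq_mul]
    field_simp
    linear_combination this

theorem vecMulVec_ne_zero {u w : Fin 3 → F} (hu : u ≠ 0) (hw : w ≠ 0) :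
    Matrix.vecMulVec u w ≠ 0 := by
  simp [Matrix.vecMulVec_eq_zero, hu, hw]

theorem vecMulVec_left_injective {w : Fin 3 → F} (hw : w ≠ 0) :
    Function.Injective ((vecMulVecBilin F F (m := Fin 3)).flip w) := by
  rw [injective_iff_map_eq_zero]
  intro u hu
  by_contra h
  exact vecMulVec_ne_zero h hw hu

theorem exists_smul_of_vecMulVec_eq {u x w y : Fin 3 → F} (hw : w ≠ 0)
    (h : Matrix.vecMulVec u w = Matrix.vecMulVec x y) : ∃ c : F, u = c • x := by
  obtain ⟨j, hj⟩ := Function.ne_iff.1 hw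
  simp only [Pi.zero_apply] at hj
  refine ⟨y j / w j, funext fun i => ?_⟩
  have : u i * w j = x i * y j := by
    simpa [Matrix.vecMulVec_apply] using congrFun (congrFun h i) j
  simp only [Pi.smul_apply, smul_eq_mul]
  field_simp
  linear_combination this

/-- Along a plane `w` = const of the first chart, every point is a pure tensor x ⊗ y of the second.
Adding a fixed such point x₀ ⊗ y₀ keeps it pure, so x ∥ x₀ or y ∥ y₀. In the first case the two
points lie in the same plane of `R`, hence are proportional. So y₀ always serves as right factor,
and dimensions finish the proof. -/
theorem AreSegreRulings.right_subset {R H H' : Set (Submodule F V)} (h : AreSegreRulings R H)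
    (h' : AreSegreRulings R H') : H ⊆ H' := by
  obtain ⟨e, hR, hH⟩ := h
  obtain ⟨e', hR', hH'⟩ := h'
  rw [hH, hH']
  rintro W ⟨w, hw, hW⟩
  have plane : ∀ u : Fin 3 → F, u ≠ 0 → ∃ u' : Fin 3 → F, u' ≠ 0 ∧
      Set.range (fun w => e (Matrix.vecMulVec u w)) =
        Set.range (fun w => e' (Matrix.vecMulVec u' w)) := by
    intro u hu
    let Z : Submodule F V := LinearMap.range (e.toLinearMap ∘ₗ vecMulVecBilin F F u)
    have hZ : Z ∈ R := by rw [hR]; exact ⟨u, hu, rfl⟩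
    rw [hR'] at hZ
    obtain ⟨u', hu', h⟩ := hZ
    exact ⟨u', hu', h⟩
  have pure : ∀ u : Fin 3 → F, u ≠ 0 → ∃ x y : Fin 3 → F, x ≠ 0 ∧ y ≠ 0 ∧
      Set.range (fun w => e (Matrix.vecMulVec u w)) =
        Set.range (fun w => e' (Matrix.vecMulVec x w)) ∧
      e (Matrix.vecMulVec u w) = e' (Matrix.vecMulVec x y) := by
    intro u hu
    obtain ⟨x, hx, hr⟩ := plane u hu
    obtain ⟨y, hy⟩ : e (Matrix.vecMulVec u w) ∈
        Set.range (fun w => e' (Matrix.vecMulVec x w)) := hr ▸ ⟨w, rfl⟩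
    refine ⟨x, y, hx, ?_, hr, hy.symm⟩
    rintro rfl
    have : e (Matrix.vecMulVec u w) = 0 := by rw [← hy]; simp
    exact vecMulVec_ne_zero hu hw (by simpa using this)
  have hu₀ : (Pi.single 0 1 : Fin 3 → F) ≠ 0 := by simp
  generalize (Pi.single 0 1 : Fin 3 → F) = u₀ at hu₀
  obtain ⟨x₀, y₀, hx₀, hy₀, hr₀, h₀⟩ := pure u₀ hu₀
  have main : ∀ u : Fin 3 → F, ∃ x : Fin 3 → F,
      e (Matrix.vecMulVec u w) = e' (Matrix.vecMulVec x y₀) := by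
    intro u
    have multiple : ∀ d : F, u = d • u₀ → ∃ x : Fin 3 → F,
        e (Matrix.vecMulVec u w) = e' (Matrix.vecMulVec x y₀) := by
      rintro d rfl
      exact ⟨d • x₀, by rw [Matrix.smul_vecMulVec, Matrix.smul_vecMulVec, map_smul, map_smul, h₀]⟩
    by_cases hu : u = 0
    · exact multiple 0 (by simpa using hu)
    by_cases hs : u₀ + u = 0
    · exact multiple (-1) (by rw [neg_one_smul]; exact (neg_eq_of_add_eq_zero_right hs).symm)
    obtain ⟨x, y, hx, hy, hr, h⟩ := pure u hu
    obtain ⟨x₁, y₁, -, -, -, h₁⟩ := pure _ hs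
    rw [Matrix.add_vecMulVec, map_add, h₀, h, ← map_add] at h₁
    rcases exists_smul_of_vecMulVec_add hx₀ hy₀ (e'.injective h₁) with ⟨c, rfl⟩ | ⟨c, rfl⟩
    -- Proportional left factors put both points in one plane of `R`, which forces u to be a
    -- multiple of u₀.
    · obtain ⟨y₂, hy₂⟩ : e (Matrix.vecMulVec u w) ∈
          Set.range (fun w => e (Matrix.vecMulVec u₀ w)) := by
        rw [hr₀, h]
        exact ⟨c • y, by simp [Matrix.smul_vecMulVec, Matrix.vecMulVec_smul]⟩
      obtain ⟨d, hd⟩ := exists_smul_of_vecMulVec_eq hw (e.injective hy₂.symm)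
      exact multiple d hd
    · exact ⟨c • x, by rw [h, Matrix.vecMulVec_smul, Matrix.smul_vecMulVec]⟩
  refine ⟨y₀, hy₀, ?_⟩
  have hW' : W = LinearMap.range (e.toLinearMap ∘ₗ (vecMulVecBilin F F).flip w) :=
    SetLike.coe_injective hW
  have heq : W = LinearMap.range (e'.toLinearMap ∘ₗ (vecMulVecBilin F F).flip y₀) := by
    rw [hW']
    apply Submodule.eq_of_le_of_finrank_eq
    · rintro _ ⟨u, rfl⟩
      obtain ⟨x, hx⟩ := main u
      exact ⟨x, hx.symm⟩
    · rw [LinearMap.finrank_range_of_inj, LinearMap.finrank_range_of_inj]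
      · exact e'.injective.comp (vecMulVec_left_injective hy₀)
      · exact e.injective.comp (vecMulVec_left_injective hw)
  rw [heq]
  rfl

/-- One system of ruling planes of a Segre variety determines the other. -/
theorem AreSegreRulings.right_unique {R H H' : Set (Submodule F V)} (h : AreSegreRulings R H)
    (h' : AreSegreRulings R H') : H = H' :=
  (h.right_subset h').antisymm (h'.right_subset h)

end

/-! ### The twisted Segre variety of the vectors `seg b τ w x`. -/

section Coordinates

variable {K L V : Type*} [Field K] [Field L] [Algebra K L] [AddCommGroup V] [Module K V]
  [Module L V] [IsScalarTower K L V]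

/-- The vector with given coordinates. -/
noncomputable def cv (b : Module.Basis (Fin 3) L V) (x y z : L) : V := x • b 0 + y • b 1 + z • b 2

variable (b : Module.Basis (Fin 3) L V) (τ : L ≃ₐ[K] L)

theorem repr_cv (x y z : L) : b.repr (cv b x y z) = ![x, y, z] := by
  ext i
  fin_cases i <;> simp [cv]

theorem repr_cv_zero (x y z : L) : b.repr (cv b x y z) 0 = x := by rw [repr_cv]; rfl

theorem repr_cv_one (x y z : L) : b.repr (cv b x y z) 1 = y := by rw [repr_cv]; rfl

theorem repr_cv_two (x y z : L) : b.repr (cv b x y z) 2 = z := by rw [repr_cv]; rfl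

variable {b}

theorem cv_inj {x y z x' y' z' : L} :
    cv b x y z = cv b x' y' z' ↔ x = x' ∧ y = y' ∧ z = z' := by
  constructor
  · intro h
    exact ⟨by rw [← repr_cv_zero b x y z, h, repr_cv_zero],
      by rw [← repr_cv_one b x y z, h, repr_cv_one],
      by rw [← repr_cv_two b x y z, h, repr_cv_two]⟩
  · rintro ⟨rfl, rfl, rfl⟩
    rfl

variable (b)

theorem exists_cv (v : V) : ∃ x y z, v = cv b x y z :=
  ⟨b.repr v 0, b.repr v 1, b.repr v 2, by
    conv_lhs => rw [← b.sum_repr v]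
    rw [Fin.sum_univ_three]
    rfl⟩

theorem cv_zero : cv b 0 0 0 = 0 := by simp [cv]

variable {b} in
theorem cv_eq_zero {x y z : L} : cv b x y z = 0 ↔ x = 0 ∧ y = 0 ∧ z = 0 := by
  rw [← cv_zero b, cv_inj]

theorem cv_add (x y z x' y' z' : L) :
    cv b x y z + cv b x' y' z' = cv b (x + x') (y + y') (z + z') := by
  simp only [cv, add_smul]
  abel

theorem smul_cv (c x y z : L) : c • cv b x y z = cv b (c * x) (c * y) (c * z) := by
  simp only [cv, smul_add, mul_smul]

theorem smul_cv' (k : K) (x y z : L) : k • cv b x y z = cv b (k • x) (k • y) (k • z) := by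
  simp only [cv, smul_add, smul_assoc]

theorem dual_cv (f : Module.Dual L V) (x y z : L) :
    f (cv b x y z) = x * f (b 0) + y * f (b 1) + z * f (b 2) := by
  simp [cv]

/-- The points `(w₀ x, w₁ x^τ, w₂ x^(τ^2))` of a Segre variety. -/
noncomputable def seg : (Fin 3 → K) →ₗ[K] L →ₗ[K] V :=
  LinearMap.mk₂ K (fun w x => cv b (w 0 • x) (w 1 • τ x) (w 2 • τ (τ x)))
    (fun w w' x => by simp [cv_add, add_smul])
    (fun k w x => by simp [smul_cv', mul_smul])
    (fun w x x' => by simp [cv_add])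
    (fun k w x => by simp only [smul_cv', map_smul, smul_comm k])

theorem seg_apply (w : Fin 3 → K) (x : L) :
    seg b τ w x = cv b (w 0 • x) (w 1 • τ x) (w 2 • τ (τ x)) := rfl

theorem seg_vec (p q r : K) (x : L) :
    seg b τ ![p, q, r] x = cv b (p • x) (q • τ x) (r • τ (τ x)) := rfl

variable {b τ}

theorem seg_eq_iff {w w' : Fin 3 → K} {x x' : L} :
    seg b τ w x = seg b τ w' x' ↔ ∀ j, w j • x = w' j • x' := by
  rw [seg_apply, seg_apply, cv_inj, Fin.forall_fin_succ, Fin.forall_fin_succ, Fin.forall_fin_one]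
  simp only [← map_smul, EmbeddingLike.apply_eq_iff_eq]
  rfl

theorem seg_eq_zero {w : Fin 3 → K} {x : L} : seg b τ w x = 0 ↔ w = 0 ∨ x = 0 := by
  have : (0 : V) = seg b τ w 0 := by simp
  rw [this, seg_eq_iff]
  simp only [smul_zero, smul_eq_zero, funext_iff, Pi.zero_apply, forall_or_right]

theorem seg_ne_zero {w : Fin 3 → K} {x : L} (hw : w ≠ 0) (hx : x ≠ 0) : seg b τ w x ≠ 0 := by
  simp [seg_eq_zero, hw, hx]

/-- The factors of a nonzero pure tensor are unique up to a scalar of `K`; a coordinate with w j ≠ 0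
reveals it. -/
theorem seg_eq_seg {w w' : Fin 3 → K} {x x' : L} (hw : w ≠ 0) (hx : x ≠ 0)
    (h : seg b τ w x = seg b τ w' x') : ∃ k : K, k ≠ 0 ∧ w = k • w' ∧ x' = k • x := by
  rw [seg_eq_iff] at h
  obtain ⟨j, hj⟩ := Function.ne_iff.1 hw
  simp only [Pi.zero_apply] at hj
  have hj' : w' j ≠ 0 := by
    intro h0
    have := h j
    rw [h0, zero_smul, smul_eq_zero] at this
    exact this.elim hj hx
  have hx' : x' = (w j / w' j) • x := by
    rw [div_eq_inv_mul, mul_smul, h j, inv_smul_smul₀ hj']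
  refine ⟨w j / w' j, div_ne_zero hj hj', funext fun i => ?_, hx'⟩
  have := h i
  rw [hx', smul_smul] at this
  rw [smul_left_injective K hx this, Pi.smul_apply, smul_eq_mul, mul_comm]

variable (b τ)

/-- The ruling plane of all `seg w x`, for fixed `x`. -/
noncomputable def leftPlane (x : L) : Submodule K V := LinearMap.range ((seg b τ).flip x)

/-- The ruling plane of all `seg w x`, for fixed `w`. -/
noncomputable def rightPlane (w : Fin 3 → K) : Submodule K V := LinearMap.range (seg b τ w)

variable {b τ}

theorem mem_leftPlane {x : L} {v : V} : v ∈ leftPlane b τ x ↔ ∃ w, seg b τ w x = v := Iff.rfl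

theorem mem_rightPlane {w : Fin 3 → K} {v : V} :
    v ∈ rightPlane b τ w ↔ ∃ x, seg b τ w x = v := Iff.rfl

theorem seg_left_injective {x : L} (hx : x ≠ 0) : Function.Injective ((seg b τ).flip x) := by
  rw [injective_iff_map_eq_zero]
  intro w hw
  exact (seg_eq_zero.1 hw).resolve_right hx

theorem seg_right_injective {w : Fin 3 → K} (hw : w ≠ 0) : Function.Injective (seg b τ w) := by
  rw [injective_iff_map_eq_zero]
  intro x hx
  exact (seg_eq_zero.1 hx).resolve_left hw

theorem finrank_leftPlane {x : L} (hx : x ≠ 0) : Module.finrank K (leftPlane b τ x) = 3 := by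
  rw [leftPlane, LinearMap.finrank_range_of_inj (seg_left_injective hx)]
  simp

theorem finrank_rightPlane (hL : Module.finrank K L = 3) {w : Fin 3 → K} (hw : w ≠ 0) :
    Module.finrank K (rightPlane b τ w) = 3 := by
  rw [rightPlane, LinearMap.finrank_range_of_inj (seg_right_injective hw), hL]

theorem rightPlane_smul {k : K} (hk : k ≠ 0) (w : Fin 3 → K) :
    rightPlane b τ (k • w) = rightPlane b τ w := by
  ext v
  simp only [mem_rightPlane]
  constructor
  · rintro ⟨x, rfl⟩
    exact ⟨k • x, by simp⟩
  · rintro ⟨x, rfl⟩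
    exact ⟨k⁻¹ • x, by simp [smul_smul, hk]⟩

theorem seg_mem_rightPlane {w w' : Fin 3 → K} {x : L} (hw : w ≠ 0) (hx : x ≠ 0) :
    seg b τ w x ∈ rightPlane b τ w' ↔ ∃ k : K, k ≠ 0 ∧ w = k • w' := by
  rw [mem_rightPlane]
  constructor
  · rintro ⟨x', h⟩
    obtain ⟨k, hk, h, -⟩ := seg_eq_seg hw hx h.symm
    exact ⟨k, hk, h⟩
  · rintro ⟨k, -, rfl⟩
    exact ⟨k • x, by simp⟩

theorem rightPlane_inj {w w' : Fin 3 → K} (hw : w ≠ 0) :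
    rightPlane b τ w = rightPlane b τ w' ↔ ∃ k : K, k ≠ 0 ∧ w = k • w' := by
  constructor
  · intro h
    rw [← seg_mem_rightPlane (b := b) (τ := τ) hw one_ne_zero, ← h]
    exact ⟨1, rfl⟩
  · rintro ⟨k, hk, rfl⟩
    exact rightPlane_smul hk w'

variable (b τ)

/-- Read each column of a 3×3 matrix as an element of `L` in a `K`-basis and twist column j by τ^j.
This is a `K`-isomorphism onto V that sends u ⊗ w to `seg w x`, where x has coordinates u. -/
theorem areSegreRulings_planes (hL : Module.finrank K L = 3) :
    AreSegreRulings {W | ∃ x : L, x ≠ 0 ∧ W = leftPlane b τ x}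
      {W | ∃ w : Fin 3 → K, w ≠ 0 ∧ W = rightPlane b τ w} := by
  have hfd : FiniteDimensional K L := Module.finite_of_finrank_pos (by omega)
  let ω : Module.Basis (Fin 3) K L := Module.finBasisOfFinrankEq K L hL
  let col : Fin 3 → Matrix (Fin 3) (Fin 3) K →ₗ[K] L := fun j =>
    ω.equivFun.symm.toLinearMap ∘ₗ LinearMap.pi fun i => Matrix.entryLinearMap K K i j
  have hcol : ∀ j M, col j M = ω.equivFun.symm fun i => M i j := fun j M => rfl
  let f : Matrix (Fin 3) (Fin 3) K →ₗ[K] V :=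
    { toFun := fun M => cv b (col 0 M) (τ (col 1 M)) (τ (τ (col 2 M)))
      map_add' := fun M N => by simp only [map_add, cv_add]
      map_smul' := fun k M => by simp only [map_smul, smul_cv', RingHom.id_apply] }
  have hf : Function.Injective f := by
    rw [injective_iff_map_eq_zero]
    intro M hM
    have h := cv_eq_zero.1 hM
    simp only [EmbeddingLike.map_eq_zero_iff] at h
    ext i j
    have hj : col j M = 0 := by
      fin_cases j
      exacts [h.1, h.2.1, h.2.2]
    rw [hcol, EmbeddingLike.map_eq_zero_iff] at hj
    exact congrFun hj i
  have hV : Module.finrank K V = 9 := by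
    have := Module.finrank_mul_finrank K L V
    rw [hL, Module.finrank_eq_card_basis b] at this
    simpa using this.symm
  have hfdV : FiniteDimensional K V := Module.finite_of_finrank_pos (by omega)
  let e := f.linearEquivOfInjective hf (by rw [hV, Module.finrank_matrix]; simp)
  have he : ∀ u w, e (Matrix.vecMulVec u w) = seg b τ w (ω.equivFun.symm u) := by
    intro u w
    have hc : ∀ j, col j (Matrix.vecMulVec u w) = w j • ω.equivFun.symm u := by
      intro j
      rw [hcol, ← map_smul]
      congr 1
      ext i
      simp [Matrix.vecMulVec_apply, mul_comm]
    simp only [e, LinearMap.linearEquivOfInjective_apply]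
    change cv b _ _ _ = _
    rw [hc, hc, hc, map_smul, map_smul, map_smul]
    rfl
  refine ⟨e, ?_, ?_⟩
  · ext W
    simp only [Set.mem_ofPred_eq, he]
    constructor
    · rintro ⟨x, hx, rfl⟩
      refine ⟨ω.equivFun x, by simpa using hx, ?_⟩
      simp only [LinearEquiv.symm_apply_apply]
      rfl
    · rintro ⟨u, hu, hW⟩
      exact ⟨ω.equivFun.symm u, (LinearEquiv.map_ne_zero_iff _).2 hu, SetLike.coe_injective hW⟩
  · ext W
    simp only [Set.mem_ofPred_eq, he]
    have hr : ∀ w, Set.range (fun u => seg b τ w (ω.equivFun.symm u)) =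
        Set.range (seg b τ w) := fun w => ω.equivFun.symm.surjective.range_comp (seg b τ w)
    simp only [hr]
    constructor
    · rintro ⟨w, hw, rfl⟩
      exact ⟨w, hw, rfl⟩
    · rintro ⟨w, hw, hW⟩
      exact ⟨w, hw, SetLike.coe_injective hW⟩

end Coordinates

/-! ### The conic w₀² = w₁w₂ and the scroll over it. -/

section Conic

variable {K L V : Type*} [Field K] [Field L] [Algebra K L] [AddCommGroup V] [Module K V]
  [Module L V] [IsScalarTower K L V] (b : Module.Basis (Fin 3) L V) (τ : L ≃ₐ[K] L)

/-- The conic `w₀² = w₁ w₂` of the plane `leftPlane b τ x`. -/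
def conicSet (x : L) : Set (ℙ K V) :=
  {X | ∃ w : Fin 3 → K, w ≠ 0 ∧ w 0 ^ 2 = w 1 * w 2 ∧ seg b τ w x ∈ X.submodule}

/-- The planes of the scroll. -/
def scroll : Set (Submodule K V) :=
  {W | ∃ w : Fin 3 → K, w ≠ 0 ∧ w 0 ^ 2 = w 1 * w 2 ∧ W = rightPlane b τ w}

variable {b τ}

theorem mk_seg_mem_conicSet {x : L} {w : Fin 3 → K} (hw : w ≠ 0) (hx : x ≠ 0) :
    Projectivization.mk K (seg b τ w x) (seg_ne_zero hw hx) ∈ conicSet b τ x ↔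
      w 0 ^ 2 = w 1 * w 2 := by
  constructor
  · rintro ⟨w', hw', h, hm⟩
    rw [Projectivization.submodule_mk, Submodule.mem_span_singleton] at hm
    obtain ⟨k, hk⟩ := hm
    have hk' : seg b τ (k • w) x = seg b τ w' x := by rw [← hk]; simp
    have := seg_left_injective hx hk'
    subst this
    have hk0 : k ≠ 0 := by rintro rfl; simp at hw'
    simp only [Pi.smul_apply, smul_eq_mul] at h
    have : k ^ 2 * (w 0 ^ 2 - w 1 * w 2) = 0 := by linear_combination h
    have := (mul_eq_zero.1 this).resolve_left (pow_ne_zero 2 hk0)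
    linear_combination this
  · intro h
    exact ⟨w, hw, h, by simp [Projectivization.submodule_mk]⟩

theorem conicSet_subset {x : L} (hx : x ≠ 0) {X : ℙ K V} (hX : X ∈ conicSet b τ x) :
    X ∈ pts (leftPlane b τ x) := by
  obtain ⟨w, hw, -, h⟩ := hX
  rw [eq_mk_of_mem (seg_ne_zero hw hx) h, mk_mem_pts]
  exact ⟨w, rfl⟩

theorem cover_scroll_inter {x : L} (hx : x ≠ 0) :
    cover (scroll b τ) ∩ pts (leftPlane b τ x) = conicSet b τ x := by
  ext X
  constructor
  · rintro ⟨⟨W, ⟨w, hw, hc, rfl⟩, hW⟩, hX⟩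
    obtain ⟨v, hv, rfl⟩ := exists_mk X
    rw [mk_mem_pts] at hW hX
    obtain ⟨w', rfl⟩ := mem_leftPlane.1 hX
    have hw' : w' ≠ 0 := by rintro rfl; simp at hv
    obtain ⟨k, -, rfl⟩ := (seg_mem_rightPlane hw' hx).1 hW
    rw [mk_seg_mem_conicSet hw' hx]
    simp only [Pi.smul_apply, smul_eq_mul]
    linear_combination k ^ 2 * hc
  · intro hX
    refine ⟨?_, conicSet_subset hx hX⟩
    obtain ⟨w, hw, hc, h⟩ := hX
    refine ⟨_, ⟨w, hw, hc, rfl⟩, ?_⟩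
    rw [eq_mk_of_mem (seg_ne_zero hw hx) h, mk_mem_pts]
    exact ⟨x, rfl⟩

/-- The form must take values in `K` on all of V. Undoing the twists on coordinates and applying a
functional f with f x ≠ 0 gives a form that restricts to f(x)²(w₀² - w₁w₂) on the plane. -/
theorem isNondegConic_conicSet (h3 : ∀ x, τ (τ (τ x)) = x) {x : L} (hx : x ≠ 0) :
    IsNondegConic (leftPlane b τ x) (conicSet b τ x) := by
  obtain ⟨f, hf⟩ : ∃ f : Module.Dual K L, f x ≠ 0 := by
    by_contra! h
    exact hx ((Module.forall_dual_apply_eq_zero_iff K x).1 h)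
  let a : Fin 3 → V →ₗ[K] L := fun j => (b.coord j).restrictScalars K
  let a₀ : V →ₗ[K] K := f ∘ₗ a 0
  let a₁ : V →ₗ[K] K := f ∘ₗ τ.toLinearMap ∘ₗ τ.toLinearMap ∘ₗ a 1
  let a₂ : V →ₗ[K] K := f ∘ₗ τ.toLinearMap ∘ₗ a 2
  have h₀ : ∀ w, a₀ (seg b τ w x) = w 0 * f x := by
    intro w
    change f (b.repr (cv b _ _ _) 0) = _
    rw [repr_cv_zero, map_smul, smul_eq_mul]
  have h₁ : ∀ w, a₁ (seg b τ w x) = w 1 * f x := by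
    intro w
    change f (τ (τ (b.repr (cv b _ _ _) 1))) = _
    rw [repr_cv_one, map_smul, map_smul, h3, map_smul, smul_eq_mul]
  have h₂ : ∀ w, a₂ (seg b τ w x) = w 2 * f x := by
    intro w
    change f (τ (b.repr (cv b _ _ _) 2)) = _
    rw [repr_cv_two, map_smul, h3, map_smul, smul_eq_mul]
  let Q : QuadraticForm K V := QuadraticMap.linMulLin a₀ a₀ - QuadraticMap.linMulLin a₁ a₂
  have hQ : ∀ w, Q (seg b τ w x) = f x ^ 2 * (w 0 ^ 2 - w 1 * w 2) := by
    intro w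
    have : Q (seg b τ w x) = a₀ (seg b τ w x) * a₀ (seg b τ w x) -
      a₁ (seg b τ w x) * a₂ (seg b τ w x) := rfl
    rw [this, h₀, h₁, h₂]
    ring
  have hQ0 : ∀ w, Q (seg b τ w x) = 0 ↔ w 0 ^ 2 = w 1 * w 2 := by
    intro w
    rw [hQ, mul_eq_zero, sub_eq_zero]
    exact or_iff_right (pow_ne_zero 2 hf)
  refine ⟨Q, ?_, ?_⟩
  · rintro _ ⟨w, rfl⟩ h hp
    have h' : w 0 ^ 2 = w 1 * w 2 := (hQ0 w).1 h
    have hpol : ∀ u : Fin 3 → K, 2 * w 0 * u 0 - w 1 * u 2 - w 2 * u 1 = 0 := by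
      intro u
      have := hp _ ⟨u, rfl⟩
      simp only [LinearMap.flip_apply] at this
      rw [QuadraticMap.polar, ← LinearMap.add_apply, ← map_add, hQ, hQ, hQ] at this
      simp only [Pi.add_apply] at this
      have : f x ^ 2 * (2 * w 0 * u 0 - w 1 * u 2 - w 2 * u 1) = 0 := by linear_combination this
      exact (mul_eq_zero.1 this).resolve_left (pow_ne_zero 2 hf)
    have hw1 : w 1 = 0 := by simpa using hpol ![0, 0, 1]
    have hw2 : w 2 = 0 := by simpa using hpol ![0, 1, 0]
    -- The equation of the conic is used here rather than the polar form, so characteristic 2, where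
    -- (1,0,0) is the nucleus, is included.
    have hw0 : w 0 = 0 := by simpa [hw1] using h'
    have : w = 0 := by ext i; fin_cases i <;> assumption
    simp [this]
  · ext X
    constructor
    · intro hX
      refine ⟨conicSet_subset hx hX, ?_⟩
      obtain ⟨w, hw, hc, h⟩ := hX
      rw [submodule_eq_span (seg_ne_zero hw hx) h]
      intro v hv
      obtain ⟨k, rfl⟩ := Submodule.mem_span_singleton.1 hv
      rw [QuadraticMap.map_smul, (hQ0 w).2 hc, smul_zero]
    · rintro ⟨hX, h⟩
      obtain ⟨v, hv, rfl⟩ := exists_mk X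
      rw [mk_mem_pts] at hX
      obtain ⟨w, rfl⟩ := mem_leftPlane.1 hX
      have hw : w ≠ 0 := by rintro rfl; simp at hv
      rw [mk_seg_mem_conicSet hw hx, ← hQ0]
      exact h _ (by simp [Projectivization.submodule_mk])

/-- The conic is parametrized by (t, t², 1) together with the point (0,1,0), which is the image of
`none`. -/
theorem ncard_scroll [Finite K] : (scroll b τ).ncard = Nat.card K + 1 := by
  let f : Option K → Submodule K V := fun o => o.elim (rightPlane b τ ![0, 1, 0])
    fun t => rightPlane b τ ![t, t ^ 2, 1]
  have hn : ∀ t : K, ![t, t ^ 2, 1] ≠ 0 := fun t h => by simpa using congrFun h 2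
  have hn' : (![0, 1, 0] : Fin 3 → K) ≠ 0 := fun h => by simpa using congrFun h 1
  have hne : ∀ t : K, rightPlane b τ ![t, t ^ 2, 1] ≠ rightPlane b τ ![0, 1, 0] := by
    intro t h
    obtain ⟨k, -, h⟩ := (rightPlane_inj (hn t)).1 h
    simpa using congrFun h 2
  have hf : Function.Injective f := by
    rintro (_ | t) (_ | t') h
    · rfl
    · exact absurd h.symm (hne t')
    · exact absurd h (hne t)
    · obtain ⟨k, -, h⟩ := (rightPlane_inj (hn t)).1 h
      have h2 : k = 1 := by simpa using (congrFun h 2).symm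
      have h0 : t = t' := by simpa [h2] using congrFun h 0
      rw [h0]
  have hr : scroll b τ = Set.range f := by
    ext W
    constructor
    · rintro ⟨w, hw, hc, rfl⟩
      by_cases h2 : w 2 = 0
      · have h0 : w 0 = 0 := by simpa [h2] using hc
        have h1 : w 1 ≠ 0 := fun h1 => hw (by ext i; fin_cases i <;> assumption)
        refine ⟨none, (rightPlane_inj hn').2 ⟨(w 1)⁻¹, inv_ne_zero h1, ?_⟩⟩
        ext i
        fin_cases i <;> simp [h0, h1, h2]
      · refine ⟨some (w 0 / w 2), (rightPlane_inj (hn _)).2 ⟨(w 2)⁻¹, inv_ne_zero h2, ?_⟩⟩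
        ext i
        fin_cases i
        · simp [div_eq_inv_mul]
        · simp only [div_pow, hc]
          simp
          field_simp
        · simp [h2]
    · rintro ⟨_ | t, rfl⟩
      · exact ⟨_, hn', by simp, rfl⟩
      · exact ⟨_, hn t, by simp, rfl⟩
  rw [hr, ← Nat.card_coe_set_eq, Nat.card_congr (Equiv.ofInjective f hf).symm,
    Finite.card_option]

/-- The planes for w and for x share just the point `seg w x`. Hence the scroll does not depend on
x, that is, on the choice of P. -/
theorem planesMeeting_conicSet {x : L} (hx : x ≠ 0) :
    planesMeeting {W | ∃ w : Fin 3 → K, w ≠ 0 ∧ W = rightPlane b τ w} (conicSet b τ x) =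
      scroll b τ := by
  ext W
  constructor
  · rintro ⟨⟨w, hw, rfl⟩, X, hX, hXW⟩
    obtain ⟨w', hw', hc, h⟩ := hX
    rw [eq_mk_of_mem (seg_ne_zero hw' hx) h, mk_mem_pts, seg_mem_rightPlane hw' hx] at hXW
    obtain ⟨k, hk, rfl⟩ := hXW
    exact ⟨_, hw', hc, (rightPlane_smul hk w).symm⟩
  · rintro ⟨w, hw, hc, rfl⟩
    exact ⟨⟨w, hw, rfl⟩, _, (mk_seg_mem_conicSet hw hx).2 hc, mk_mem_pts.2 ⟨x, rfl⟩⟩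

end Conic

/-! ### The action of σ in a cyclic frame: fixed planes, fixed points, the specified conic. -/

/-- In the coordinates of `b`, the map `s` is `(x, y, z) ↦ (z^τ, x^τ, y^τ)`. -/
structure IsCyclicFrame {K L V : Type*} [Field K] [Field L] [Algebra K L] [AddCommGroup V]
    [Module K V] [Module L V] (b : Module.Basis (Fin 3) L V) (τ : L ≃ₐ[K] L) (s : V ≃ₗ[K] V) :
    Prop where
  map_cv : ∀ x y z, s (cv b x y z) = cv b (τ z) (τ x) (τ y)

section Frame

variable {K L V : Type*} [Field K] [Field L] [Algebra K L] [AddCommGroup V] [Module K V]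
  [Module L V] [IsScalarTower K L V] {b : Module.Basis (Fin 3) L V} {τ : L ≃ₐ[K] L}
  {s : V ≃ₗ[K] V}

theorem cv_eq_seg (x : L) : cv b x 0 0 = seg b τ ![1, 0, 0] x := by
  rw [seg_vec]; simp

theorem seg_eq_sum (w : Fin 3 → K) (x : L) :
    seg b τ w x = w 0 • seg b τ ![1, 0, 0] x + w 1 • seg b τ ![0, 1, 0] x +
      w 2 • seg b τ ![0, 0, 1] x := by
  simp [seg_apply, smul_cv', cv_add]

theorem vec_zero_ne : (![1, 0, 0] : Fin 3 → K) ≠ 0 := fun h => by simpa using congrFun h 0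

theorem vec_one_ne : (![0, 1, 0] : Fin 3 → K) ≠ 0 := fun h => by simpa using congrFun h 1

theorem vec_two_ne : (![0, 0, 1] : Fin 3 → K) ≠ 0 := fun h => by simpa using congrFun h 2

theorem vec_ones_ne : (![1, 1, 1] : Fin 3 → K) ≠ 0 := fun h => by simpa using congrFun h 0

namespace IsCyclicFrame

/-- The twists in `seg` are matched to the frame: with τ³ = 1, the map acts on w alone. -/
theorem map_seg (hs : IsCyclicFrame b τ s) (hτ : IsCubicTwist τ) (w : Fin 3 → K) (x : L) :
    s (seg b τ w x) = seg b τ ![w 2, w 0, w 1] x := by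
  rw [seg_apply, hs.map_cv, seg_vec, map_smul, map_smul, map_smul, hτ.cube]

theorem map_seg_zero (hs : IsCyclicFrame b τ s) (hτ : IsCubicTwist τ) (x : L) :
    s (seg b τ ![1, 0, 0] x) = seg b τ ![0, 1, 0] x := hs.map_seg hτ _ x

theorem map_seg_one (hs : IsCyclicFrame b τ s) (hτ : IsCubicTwist τ) (x : L) :
    s (seg b τ ![0, 1, 0] x) = seg b τ ![0, 0, 1] x := hs.map_seg hτ _ x

theorem orbitSpan_eq (hs : IsCyclicFrame b τ s) (hτ : IsCubicTwist τ) {x : L} (hx : x ≠ 0) :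
    orbitSpan s (Projectivization.mk K (seg b τ ![1, 0, 0] x) (seg_ne_zero vec_zero_ne hx)) =
      leftPlane b τ x := by
  simp only [orbitSpan, act_mk, Projectivization.submodule_mk, hs.map_seg_zero hτ,
    hs.map_seg_one hτ]
  apply le_antisymm
  · simp only [sup_le_iff, Submodule.span_singleton_le_iff_mem]
    exact ⟨⟨⟨_, rfl⟩, ⟨_, rfl⟩⟩, ⟨_, rfl⟩⟩
  · rintro _ ⟨w, rfl⟩
    simp only [LinearMap.flip_apply, seg_eq_sum w x]
    refine Submodule.add_mem_sup (Submodule.add_mem_sup ?_ ?_) ?_ <;>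
      exact Submodule.smul_mem _ _ (Submodule.mem_span_singleton_self _)

theorem map_leftPlane (hs : IsCyclicFrame b τ s) (hτ : IsCubicTwist τ) {x : L} (hx : x ≠ 0) :
    (leftPlane b τ x).map s.toLinearMap = leftPlane b τ x := by
  have hfd : FiniteDimensional K (leftPlane b τ x) :=
    Module.finite_of_finrank_pos (by rw [finrank_leftPlane hx]; omega)
  apply Submodule.eq_of_le_of_finrank_eq
  · rintro _ ⟨_, ⟨w, rfl⟩, rfl⟩
    exact ⟨_, (hs.map_seg hτ w x).symm⟩
  · exact LinearEquiv.finrank_map_eq s _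

/-- A fixed plane through a point x • b 0 of ⟦G⟧ contains its orbit, which spans `leftPlane b τ x`;
both have dimension 3. -/
theorem setG_eq (hs : IsCyclicFrame b τ s) (hτ : IsCubicTwist τ) {φ : Equiv.Perm (ℙ L V)}
    {G : ℙ L V} (hG : TypeIII φ G) (hb : b 0 ∈ G.submodule) :
    setG φ s G = {W | ∃ x : L, x ≠ 0 ∧ W = leftPlane b τ x} := by
  have hspan := submodule_eq_span (b.ne_zero 0) hb
  ext π
  constructor
  · rintro ⟨⟨h3, hπ, -⟩, X, hX, hXG⟩
    obtain ⟨v, hv, rfl⟩ := exists_mk X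
    rw [mk_mem_pts] at hX hXG
    change v ∈ G.submodule at hXG
    rw [hspan, Submodule.mem_span_singleton] at hXG
    obtain ⟨x, rfl⟩ := hXG
    have hx : x ≠ 0 := by rintro rfl; simp at hv
    refine ⟨x, hx, ?_⟩
    have e : x • b 0 = seg b τ ![1, 0, 0] x := by rw [← cv_eq_seg]; simp [cv]
    have hmap : ∀ u ∈ π, s u ∈ π := fun u hu => hπ ▸ ⟨u, hu, rfl⟩
    have hfd : FiniteDimensional K π := Module.finite_of_finrank_pos (by omega)
    symm
    apply Submodule.eq_of_le_of_finrank_eq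
    · rw [← hs.orbitSpan_eq hτ hx]
      rw [e] at hX
      simp only [orbitSpan, act_mk, Projectivization.submodule_mk, sup_le_iff,
        Submodule.span_singleton_le_iff_mem]
      exact ⟨⟨hX, hmap _ hX⟩, hmap _ (hmap _ hX)⟩
    · rw [finrank_leftPlane hx, h3]
  · rintro ⟨x, hx, rfl⟩
    have hX0 := seg_ne_zero (b := b) (τ := τ) (vec_zero_ne (K := K)) hx
    have hXG : Projectivization.mk K (seg b τ ![1, 0, 0] x) hX0 ∈ pts (bose K G.submodule) := by
      rw [mk_mem_pts]
      change _ ∈ G.submodule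
      rw [hspan, Submodule.mem_span_singleton, ← cv_eq_seg]
      exact ⟨x, by simp [cv]⟩
    have hXπ : Projectivization.mk K (seg b τ ![1, 0, 0] x) hX0 ∈ pts (leftPlane b τ x) :=
      mk_mem_pts.2 ⟨_, rfl⟩
    refine ⟨⟨finrank_leftPlane hx, hs.map_leftPlane hτ hx, _, hXπ, ⟨G, hG, hXG⟩, ?_⟩,
      _, hXπ, hXG⟩
    rintro ⟨ℓ, h2, h⟩
    have hle : leftPlane b τ x ≤ ℓ := by
      rw [← hs.orbitSpan_eq hτ hx]
      exact sup_le (sup_le h.1 h.2.1) h.2.2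
    have hfd : FiniteDimensional K ℓ := Module.finite_of_finrank_pos (by omega)
    have := Submodule.finrank_mono hle
    rw [finrank_leftPlane hx] at this
    omega

/-- A fixed point is an eigenvector whose eigenvalue k lies in `K`. As s³ = 1, k³ = 1 and so k = 1,
and the coordinates are successive conjugates. -/
theorem eq_ones_of_act_eq (hs : IsCyclicFrame b τ s) (hτ : IsCubicTwist τ) {v : V} (hv : v ≠ 0)
    (h : act s (Projectivization.mk K v hv) = Projectivization.mk K v hv) :
    ∃ x, seg b τ ![1, 1, 1] x = v := by
  rw [act_mk, Projectivization.mk_eq_mk_iff'] at h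
  obtain ⟨k, hk⟩ := h
  obtain ⟨x, y, z, rfl⟩ := exists_cv b v
  rw [hs.map_cv, smul_cv', cv_inj] at hk
  obtain ⟨h0, h1, h2⟩ := hk
  have hk3 : k ^ 3 = 1 := by
    have hx : k ^ 3 • x = x := by
      rw [pow_succ, mul_smul, h0, ← map_smul, pow_two, mul_smul, h2, ← map_smul, h1,
        hτ.cube]
    have hy : k ^ 3 • y = y := by
      rw [pow_succ, mul_smul, h1, ← map_smul, pow_two, mul_smul, h0, ← map_smul, h2,
        hτ.cube]
    have hz : k ^ 3 • z = z := by
      rw [pow_succ, mul_smul, h2, ← map_smul, pow_two, mul_smul, h1, ← map_smul, h0,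
        hτ.cube]
    by_contra hne
    apply hv
    have key : ∀ u : L, k ^ 3 • u = u → u = 0 := by
      intro u hu
      have : (k ^ 3 - 1) • u = 0 := by rw [sub_smul, hu, one_smul, sub_self]
      exact (smul_eq_zero.1 this).resolve_left (sub_ne_zero.2 hne)
    rw [key x hx, key y hy, key z hz, cv_zero]
  have hk1 : k = 1 := hτ.cube_bij.1 (by simpa using hk3)
  rw [hk1, one_smul] at h0 h1 h2
  refine ⟨x, ?_⟩
  rw [seg_vec, one_smul, one_smul, one_smul, h2, h1]

theorem act_ones (hs : IsCyclicFrame b τ s) (hτ : IsCubicTwist τ) {x : L}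
    (hx : seg b τ (![1, 1, 1] : Fin 3 → K) x ≠ 0) :
    act s (Projectivization.mk K _ hx) = Projectivization.mk K _ hx := by
  simp only [act_mk, hs.map_seg hτ]
  rfl

theorem isPtwiseFixedPlane_ones (hs : IsCyclicFrame b τ s) (hτ : IsCubicTwist τ)
    (hL : Module.finrank K L = 3) : IsPtwiseFixedPlane s (rightPlane b τ ![1, 1, 1]) := by
  refine ⟨finrank_rightPlane hL vec_ones_ne, ?_⟩
  intro X hX
  obtain ⟨v, hv, rfl⟩ := exists_mk X
  rw [mk_mem_pts] at hX
  obtain ⟨x, rfl⟩ := hX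
  exact hs.act_ones hτ hv

/-- Besides uniqueness, this shows that the planes of w = (1,1,1) in frames for different points G
coincide. -/
theorem eq_of_isPtwiseFixedPlane (hs : IsCyclicFrame b τ s) (hτ : IsCubicTwist τ)
    (hL : Module.finrank K L = 3) {π : Submodule K V} (h : IsPtwiseFixedPlane s π) :
    π = rightPlane b τ ![1, 1, 1] := by
  have h9 := finrank_rightPlane (b := b) (τ := τ) hL (vec_ones_ne (K := K))
  have hfd : FiniteDimensional K (rightPlane b τ (![1, 1, 1] : Fin 3 → K)) :=
    Module.finite_of_finrank_pos (by omega)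
  apply Submodule.eq_of_le_of_finrank_eq
  · intro v hv
    by_cases hv0 : v = 0
    · rw [hv0]; exact Submodule.zero_mem _
    exact hs.eq_ones_of_act_eq hτ hv0 (h.2 _ (mk_mem_pts.2 hv))
  · rw [h9, h.1]

end IsCyclicFrame

theorem mem_span_sup_span {F V : Type*} [Field F] [AddCommGroup V] [Module F V] {u u' v : V} :
    v ∈ Submodule.span F {u} ⊔ Submodule.span F {u'} ↔ ∃ p q : F, p • u + q • u' = v := by
  rw [Submodule.mem_sup]
  simp only [Submodule.mem_span_singleton]
  constructor
  · rintro ⟨_, ⟨p, rfl⟩, _, ⟨q, rfl⟩, h⟩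
    exact ⟨p, q, h⟩
  · rintro ⟨p, q, h⟩
    exact ⟨_, ⟨p, rfl⟩, _, ⟨q, rfl⟩, h⟩

theorem mem_span_seg_zero_one {x : L} {v : V} :
    v ∈ Submodule.span K {seg b τ ![1, 0, 0] x} ⊔ Submodule.span K {seg b τ ![0, 1, 0] x} ↔
      ∃ p q : K, seg b τ ![p, q, 0] x = v := by
  rw [mem_span_sup_span]
  simp [seg_vec, smul_cv', cv_add]

theorem mem_span_seg_zero_two {x : L} {v : V} :
    v ∈ Submodule.span K {seg b τ ![1, 0, 0] x} ⊔ Submodule.span K {seg b τ ![0, 0, 1] x} ↔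
      ∃ p q : K, seg b τ ![p, 0, q] x = v := by
  rw [mem_span_sup_span]
  simp [seg_vec, smul_cv', cv_add]

theorem mk_seg_eq_mk_seg {x : L} (hx : x ≠ 0) {w w' : Fin 3 → K} {h : seg b τ w x ≠ 0}
    {h' : seg b τ w' x ≠ 0} :
    Projectivization.mk K _ h = Projectivization.mk K _ h' ↔ ∃ k : K, k • w' = w := by
  rw [Projectivization.mk_eq_mk_iff']
  apply exists_congr
  intro k
  rw [← LinearMap.smul_apply, ← map_smul]
  exact (seg_left_injective hx).eq_iff

theorem isSpecifiedConic_conicSet (hs : IsCyclicFrame b τ s) (hτ : IsCubicTwist τ) {x : L}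
    (hx : x ≠ 0) :
    IsSpecifiedConic s
      (Projectivization.mk K _ (seg_ne_zero (b := b) (τ := τ) (vec_zero_ne (K := K)) hx))
      (Projectivization.mk K _ (seg_ne_zero (b := b) (τ := τ) (vec_ones_ne (K := K)) hx))
      (conicSet b τ x) := by
  simp only [IsSpecifiedConic, hs.orbitSpan_eq hτ hx, act_mk, hs.map_seg_zero hτ,
    hs.map_seg_one hτ, Projectivization.submodule_mk]
  refine ⟨isNondegConic_conicSet hτ.cube hx, ?_, ?_, ?_, ?_, ?_⟩
  · exact (mk_seg_mem_conicSet (vec_ones_ne (K := K)) hx).2 (by simp)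
  · exact (mk_seg_mem_conicSet (vec_one_ne (K := K)) hx).2 (by simp)
  · exact (mk_seg_mem_conicSet (vec_two_ne (K := K)) hx).2 (by simp)
  · refine ⟨Projectivization.mk K _
      (seg_ne_zero (b := b) (τ := τ) (vec_one_ne (K := K)) hx), ⟨?_, ?_⟩, ?_⟩
    · exact (mk_seg_mem_conicSet (vec_one_ne (K := K)) hx).2 (by simp)
    · rw [mk_mem_pts, mem_span_seg_zero_one]; exact ⟨0, 1, rfl⟩
    · rintro Y ⟨hY, hY'⟩
      obtain ⟨v, hv, rfl⟩ := exists_mk Y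
      rw [mk_mem_pts, mem_span_seg_zero_one] at hY'
      obtain ⟨p, q, rfl⟩ := hY'
      have hw : (![p, q, 0] : Fin 3 → K) ≠ 0 := by intro h; simp [h] at hv
      -- On the line w₂ = 0 the conic reads w₀² = 0.
      have hp : p = 0 := by simpa using (mk_seg_mem_conicSet hw hx).1 hY
      rw [mk_seg_eq_mk_seg hx]
      exact ⟨q, by simp [hp]⟩
  · refine ⟨Projectivization.mk K _
      (seg_ne_zero (b := b) (τ := τ) (vec_two_ne (K := K)) hx), ⟨?_, ?_⟩, ?_⟩
    · exact (mk_seg_mem_conicSet (vec_two_ne (K := K)) hx).2 (by simp)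
    · rw [mk_mem_pts, mem_span_seg_zero_two]; exact ⟨0, 1, rfl⟩
    · rintro Y ⟨hY, hY'⟩
      obtain ⟨v, hv, rfl⟩ := exists_mk Y
      rw [mk_mem_pts, mem_span_seg_zero_two] at hY'
      obtain ⟨p, q, rfl⟩ := hY'
      have hw : (![p, 0, q] : Fin 3 → K) ≠ 0 := by intro h; simp [h] at hv
      have hp : p = 0 := by simpa using (mk_seg_mem_conicSet hw hx).1 hY
      rw [mk_seg_eq_mk_seg hx]
      exact ⟨q, by simp [hp]⟩

theorem quadraticForm_seg (Q : QuadraticForm K V) (x : L) : ∃ α β γ δ ε ζ : K,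
    ∀ w : Fin 3 → K, Q (seg b τ w x) = α * w 0 ^ 2 + β * w 1 ^ 2 + γ * w 2 ^ 2 +
      δ * w 0 * w 1 + ε * w 0 * w 2 + ζ * w 1 * w 2 := by
  refine ⟨Q (seg b τ ![1, 0, 0] x), Q (seg b τ ![0, 1, 0] x), Q (seg b τ ![0, 0, 1] x),
    QuadraticMap.polar Q (seg b τ ![1, 0, 0] x) (seg b τ ![0, 1, 0] x),
    QuadraticMap.polar Q (seg b τ ![1, 0, 0] x) (seg b τ ![0, 0, 1] x),
    QuadraticMap.polar Q (seg b τ ![0, 1, 0] x) (seg b τ ![0, 0, 1] x), fun w => ?_⟩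
  rw [seg_eq_sum w, QuadraticMap.map_add Q (_ + _), QuadraticMap.map_add Q (w 0 • _),
    QuadraticMap.polar_add_left]
  simp only [QuadraticMap.map_smul, QuadraticMap.polar_smul_left, QuadraticMap.polar_smul_right,
    smul_eq_mul]
  ring

/-- Among the six coefficients of a ternary quadratic form, P^σ and P^(σ²) kill those of w₁² and
w₂², the two tangents those of w₀w₁ and w₀w₂, and A relates the other two. A multiple of w₀² - w₁w₂
remains, nonzero by non-degeneracy. -/
theorem eq_conicSet_of_isSpecifiedConic (hs : IsCyclicFrame b τ s) (hτ : IsCubicTwist τ) {x : L}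
    (hx : x ≠ 0) {C : Set (ℙ K V)}
    (hC : IsSpecifiedConic s
      (Projectivization.mk K _ (seg_ne_zero (b := b) (τ := τ) (vec_zero_ne (K := K)) hx))
      (Projectivization.mk K _ (seg_ne_zero (b := b) (τ := τ) (vec_ones_ne (K := K)) hx)) C) :
    C = conicSet b τ x := by
  simp only [IsSpecifiedConic, hs.orbitSpan_eq hτ hx, act_mk, hs.map_seg_zero hτ,
    hs.map_seg_one hτ, Projectivization.submodule_mk] at hC
  obtain ⟨⟨Q, hnd, hQ⟩, hA, h1, h2, ht1, ht2⟩ := hC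
  have hmem : ∀ (w : Fin 3 → K) (hw : seg b τ w x ≠ 0),
      Projectivization.mk K _ hw ∈ C ↔ Q (seg b τ w x) = 0 := by
    intro w hw
    rw [hQ]
    change (_ ∧ _) ↔ _
    rw [mk_mem_pts, Projectivization.submodule_mk]
    constructor
    · exact fun h => h.2 _ (Submodule.mem_span_singleton_self _)
    · refine fun h => ⟨⟨w, rfl⟩, fun v hv => ?_⟩
      obtain ⟨k, rfl⟩ := Submodule.mem_span_singleton.1 hv
      rw [QuadraticMap.map_smul, h, smul_zero]
  obtain ⟨α, β, γ, δ, ε, ζ, hq⟩ := quadraticForm_seg (b := b) (τ := τ) Q x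
  rw [hmem, hq] at hA h1 h2
  have hβ : β = 0 := by simpa using h1
  have hγ : γ = 0 := by simpa using h2
  subst hβ hγ
  have hδ : δ = 0 := by
    by_contra hδ
    -- On w₂ = 0 the form is w₀(αw₀ + δw₁); this is its second zero, distinct from (0,1,0) when δ ≠
    -- 0.
    have hw : (![δ, -α, 0] : Fin 3 → K) ≠ 0 := fun h => hδ (by simpa using congrFun h 0)
    have := ht1.unique (y₁ := Projectivization.mk K _ (seg_ne_zero hw hx))
      (y₂ := Projectivization.mk K _ (seg_ne_zero vec_one_ne hx))
      ⟨(hmem _ _).2 (by rw [hq]; simp; ring), mk_mem_pts.2 (mem_span_seg_zero_one.2 ⟨_, _, rfl⟩)⟩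
      ⟨(hmem _ _).2 (by rw [hq]; simp), mk_mem_pts.2 (mem_span_seg_zero_one.2 ⟨_, _, rfl⟩)⟩
    rw [mk_seg_eq_mk_seg hx] at this
    obtain ⟨k, hk⟩ := this
    exact hδ (by simpa using (congrFun hk 0).symm)
  have hε : ε = 0 := by
    by_contra hε
    have hw : (![ε, 0, -α] : Fin 3 → K) ≠ 0 := fun h => hε (by simpa using congrFun h 0)
    have := ht2.unique (y₁ := Projectivization.mk K _ (seg_ne_zero hw hx))
      (y₂ := Projectivization.mk K _ (seg_ne_zero vec_two_ne hx))
      ⟨(hmem _ _).2 (by rw [hq]; simp; ring), mk_mem_pts.2 (mem_span_seg_zero_two.2 ⟨_, _, rfl⟩)⟩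
      ⟨(hmem _ _).2 (by rw [hq]; simp), mk_mem_pts.2 (mem_span_seg_zero_two.2 ⟨_, _, rfl⟩)⟩
    rw [mk_seg_eq_mk_seg hx] at this
    obtain ⟨k, hk⟩ := this
    exact hε (by simpa using (congrFun hk 0).symm)
  subst hδ hε
  have hζ : ζ = -α := by
    have : α + ζ = 0 := by simpa using hA
    linear_combination this
  subst hζ
  have hα : α ≠ 0 := by
    rintro rfl
    have hz : ∀ w, Q (seg b τ w x) = 0 := fun w => by rw [hq]; ring
    apply seg_ne_zero (b := b) (τ := τ) (vec_zero_ne (K := K)) hx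
    refine hnd _ ⟨_, rfl⟩ (hz _) ?_
    rintro _ ⟨w, rfl⟩
    simp only [LinearMap.flip_apply]
    rw [QuadraticMap.polar, ← LinearMap.add_apply, ← map_add, hz, hz, hz]
    ring
  ext X
  have hsub : X ∈ C → X ∈ pts (leftPlane b τ x) := fun h => by rw [hQ] at h; exact h.1
  by_cases hX : X ∈ pts (leftPlane b τ x)
  · obtain ⟨v, hv, rfl⟩ := exists_mk X
    rw [mk_mem_pts] at hX
    obtain ⟨w, rfl⟩ := mem_leftPlane.1 hX
    have hw : w ≠ 0 := by rintro rfl; simp at hv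
    rw [hmem, mk_seg_mem_conicSet hw hx, hq]
    constructor
    · intro h
      have : α * (w 0 ^ 2 - w 1 * w 2) = 0 := by linear_combination h
      have := (mul_eq_zero.1 this).resolve_left hα
      linear_combination this
    · intro h
      linear_combination α * h
  · exact ⟨fun h => absurd (hsub h) hX, fun h => absurd (conicSet_subset hx h) hX⟩

end Frame

/-! ### The sets E_G and F_G in coordinates. -/

section Blocks

variable {K L V : Type*} [Field K] [Field L] [Algebra K L] [AddCommGroup V] [Module K V]
  [Module L V] [IsScalarTower K L V] {b : Module.Basis (Fin 3) L V} {τ : L ≃ₐ[K] L}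
  {s : V ≃ₗ[K] V} {φ : Equiv.Perm (ℙ L V)} {G : ℙ L V}

theorem Induces.apply_mk (h : Induces s φ) {v : V} (hv : v ≠ 0) (hv' : s v ≠ 0) :
    φ (Projectivization.mk L v hv) = Projectivization.mk L (s v) hv' := by
  apply eq_mk_of_mem
  have : s v ∈ (bose K (Projectivization.mk L v hv).submodule).map s.toLinearMap :=
    ⟨v, by simp [bose, Projectivization.submodule_mk], rfl⟩
  rw [h] at this
  exact this

theorem IsCyclicFrame.cube (hs : IsCyclicFrame b τ s) (hτ : IsCubicTwist τ) (v : V) :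
    s (s (s v)) = v := by
  obtain ⟨x, y, z, rfl⟩ := exists_cv b v
  simp only [hs.map_cv, hτ.cube]

theorem cv_basis_zero : cv b 1 0 0 = b 0 := by simp [cv]

theorem cv_basis_one : cv b 0 1 0 = b 1 := by simp [cv]

theorem cv_basis_two : cv b 0 0 1 = b 2 := by simp [cv]

theorem IsCyclicFrame.map_basis_zero (hs : IsCyclicFrame b τ s) : s (b 0) = b 1 := by
  rw [← cv_basis_zero, hs.map_cv, ← cv_basis_one]; simp

theorem IsCyclicFrame.map_basis_one (hs : IsCyclicFrame b τ s) : s (b 1) = b 2 := by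
  rw [← cv_basis_one, hs.map_cv, ← cv_basis_two]; simp

theorem IsCyclicFrame.apply_eq (hs : IsCyclicFrame b τ s) (hφ : Induces s φ)
    (hb : b 0 ∈ G.submodule) : φ G = Projectivization.mk L (b 1) (b.ne_zero 1) := by
  rw [eq_mk_of_mem (b.ne_zero 0) hb, hφ.apply_mk (b.ne_zero 0) (by simpa using b.ne_zero 0)]
  simp only [hs.map_basis_zero]

theorem IsCyclicFrame.apply_apply_eq (hs : IsCyclicFrame b τ s) (hφ : Induces s φ)
    (hb : b 0 ∈ G.submodule) : φ (φ G) = Projectivization.mk L (b 2) (b.ne_zero 2) := by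
  rw [hs.apply_eq hφ hb, hφ.apply_mk (b.ne_zero 1) (by simpa using b.ne_zero 1)]
  simp only [hs.map_basis_one]

theorem mem_mLine (hs : IsCyclicFrame b τ s) (hφ : Induces s φ) (hb : b 0 ∈ G.submodule) {v : V} :
    v ∈ mLine φ G ↔ ∃ y z, v = cv b 0 y z := by
  rw [mLine, hs.apply_apply_eq hφ hb, hs.apply_eq hφ hb, Projectivization.submodule_mk,
    Projectivization.submodule_mk, mem_span_sup_span]
  simp only [cv, zero_smul, zero_add, eq_comm]

theorem ne_zero_of_norm_add {y z : L} (h : y * τ y * τ (τ y) + z * τ z * τ (τ z) = 0)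
    (hv : cv b 0 y z ≠ 0) : y ≠ 0 ∧ z ≠ 0 := by
  constructor
  · rintro rfl
    have hz : z = 0 := by simpa using h
    exact hv (by rw [hz, cv_zero])
  · rintro rfl
    have hy : y = 0 := by simpa using h
    exact hv (by rw [hy, cv_zero])

/-- The determinant of the coordinate rows of v, s v, s² v is N(y) + N(z). -/
theorem typeII_mk_iff (hs : IsCyclicFrame b τ s) (hφ : Induces s φ)
    {y z : L} (hv : cv b 0 y z ≠ 0) :
    TypeII φ (Projectivization.mk L _ hv) ↔ y * τ y * τ (τ y) + z * τ z * τ (τ z) = 0 := by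
  have hV : Module.finrank L V = 3 := by rw [Module.finrank_eq_card_basis b]; simp
  have hv1 : s (cv b 0 y z) ≠ 0 := by simpa using hv
  have hv2 : s (s (cv b 0 y z)) ≠ 0 := by simpa using hv
  rw [TypeII, hφ.apply_mk hv hv1, hφ.apply_mk hv1 hv2, collinear3_mk_iff hV]
  simp only [hs.map_cv, dual_cv, map_zero, zero_mul, zero_add, add_zero]
  constructor
  · rintro ⟨-, f, hf, h0, h1, h2⟩
    by_contra hne
    apply hf
    -- Cramer's rule: the coefficients below are cofactors of that determinant.
    have key : ∀ i, (y * τ y * τ (τ y) + z * τ z * τ (τ z)) * f (b i) = 0 := by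
      intro i
      fin_cases i
      · simp only [Fin.zero_eta]
        linear_combination y * τ y * h2 - τ y * τ (τ z) * h0 + z * τ (τ z) * h1
      · simp only [Fin.mk_one]
        linear_combination τ y * τ (τ y) * h0 - z * τ (τ y) * h1 + z * τ z * h2
      · simp only [Fin.reduceFinMk]
        linear_combination y * τ (τ y) * h1 - y * τ z * h2 + τ z * τ (τ z) * h0
    refine b.ext fun i => ?_
    rw [LinearMap.zero_apply]
    exact (mul_eq_zero.1 (key i)).resolve_left hne
  · intro h
    obtain ⟨hy, hz⟩ := ne_zero_of_norm_add h hv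
    have hz' : τ z ≠ 0 := by simpa using hz
    constructor
    · rw [ne_eq, Projectivization.mk_eq_mk_iff']
      rintro ⟨c, hc⟩
      rw [smul_cv, cv_inj] at hc
      exact hz' (by simpa using hc.1.symm)
    -- The functional is the cross product of v and s v.
    · refine ⟨b.constr L ![τ y * y, z * τ z, -y * τ z], ?_, ?_, ?_, ?_⟩
      · intro h0
        have := LinearMap.congr_fun h0 (b 1)
        simp [hz, hz'] at this
      · simp; ring
      · simp; ring
      · simp
        linear_combination h

theorem setE_eq (hs : IsCyclicFrame b τ s) (hτ : IsCubicTwist τ) (hφ : Induces s φ)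
    (hb : b 0 ∈ G.submodule) :
    setE φ G = {P | ∃ x : L, x ≠ 0 ∧ seg b τ (![0, 1, -1] : Fin 3 → K) x ∈ P.submodule} := by
  ext P
  constructor
  · rintro ⟨hP, h2⟩
    obtain ⟨v, hv, rfl⟩ := exists_mk P
    rw [mk_mem_pts, mem_mLine hs hφ hb] at hP
    obtain ⟨y, z, rfl⟩ := hP
    rw [typeII_mk_iff hs hφ hv] at h2
    obtain ⟨hy, hz⟩ := ne_zero_of_norm_add h2 hv
    have hy1 : τ y ≠ 0 := by simpa using hy
    have hy2 : τ (τ y) ≠ 0 := by simpa using hy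
    -- Since N(-z/y) = 1, Hilbert 90 gives τ u = -(z/y) u, so (0, u, -τ u) is a multiple of (0, y,
    -- z).
    obtain ⟨u, hu, hu'⟩ := hτ.hilbert (-z / y) (by
      simp only [map_div₀, map_neg]
      field_simp
      linear_combination -h2)
    refine ⟨τ (τ u), by simpa using hu, ?_⟩
    rw [Projectivization.submodule_mk, Submodule.mem_span_singleton]
    refine ⟨u / y, ?_⟩
    rw [seg_vec, smul_cv, hτ.cube, hu', cv_inj]
    refine ⟨by simp, ?_, ?_⟩
    · rw [one_smul]; field_simp
    · rw [neg_one_smul]; field_simp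
  · rintro ⟨x, hx, hP⟩
    rw [seg_vec, zero_smul, one_smul, neg_one_smul] at hP
    have hv : cv b 0 (τ x) (-τ (τ x)) ≠ 0 := by
      rw [ne_eq, cv_eq_zero]
      simp [hx]
    rw [eq_mk_of_mem hv hP]
    refine ⟨mk_mem_pts.2 ((mem_mLine hs hφ hb).2 ⟨_, _, rfl⟩), ?_⟩
    rw [typeII_mk_iff hs hφ hv]
    simp only [map_neg, hτ.cube]
    ring

theorem collinear3_seg {x : L} (hx : x ≠ 0) {w₁ w₂ w₃ : Fin 3 → K} (h₁ : seg b τ w₁ x ≠ 0)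
    (h₂ : seg b τ w₂ x ≠ 0) (h₃ : seg b τ w₃ x ≠ 0) {f : Module.Dual K (Fin 3 → K)} (hf : f ≠ 0)
    (hf₁ : f w₁ = 0) (hf₂ : f w₂ = 0) (hf₃ : f w₃ = 0) :
    Collinear3 (Projectivization.mk K _ h₁) (Projectivization.mk K _ h₂)
      (Projectivization.mk K _ h₃) := by
  refine ⟨(LinearMap.ker f).map ((seg b τ).flip x), ?_, ?_⟩
  · rw [← (Submodule.equivMapOfInjective _ (seg_left_injective hx) _).finrank_eq]
    exact finrank_ker_of_ne_zero (by simp) hf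
  · simp only [mk_mem_pts]
    exact ⟨⟨_, hf₁, rfl⟩, ⟨_, hf₂, rfl⟩, ⟨_, hf₃, rfl⟩⟩

theorem exists_relation_of_collinear3 {F W : Type*} [Field F] [AddCommGroup W] [Module F W]
    {u v w : W} {hu : u ≠ 0} {hv : v ≠ 0} {hw : w ≠ 0}
    (h : Collinear3 (Projectivization.mk F u hu) (Projectivization.mk F v hv)
      (Projectivization.mk F w hw)) :
    ∃ p q r : F, p • u + q • v + r • w = 0 ∧ (p ≠ 0 ∨ q ≠ 0 ∨ r ≠ 0) := by
  obtain ⟨ℓ, h2, h⟩ := h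
  simp only [mk_mem_pts] at h
  have hli : ¬ LinearIndependent F ![u, v, w] := by
    intro hli
    have h3 := finrank_span_eq_card hli
    have hle : Submodule.span F (Set.range ![u, v, w]) ≤ ℓ := by
      rw [Submodule.span_le]
      rintro _ ⟨i, rfl⟩
      fin_cases i
      exacts [h.1, h.2.1, h.2.2]
    have hfd : FiniteDimensional F ℓ := Module.finite_of_finrank_pos (by omega)
    have := Submodule.finrank_mono hle
    rw [h3, h2] at this
    simp at this
  rw [Fintype.not_linearIndependent_iff] at hli
  obtain ⟨g, hg, i, hi⟩ := hli
  refine ⟨g 0, g 1, g 2, by simpa [Fin.sum_univ_three] using hg, ?_⟩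
  fin_cases i
  exacts [Or.inl hi, Or.inr (Or.inl hi), Or.inr (Or.inr hi)]

/-- For (0, y, z) of Type II, y and z are nonzero. A `K`-relation p, q, r on its orbit then gives q²
= pr and p² = qr, so p³ = q³ and p = q. Hence z = -τ y, which is the shape w = (0,1,-1). -/
theorem pts_beta (hs : IsCyclicFrame b τ s) (hτ : IsCubicTwist τ) (hφ : Induces s φ)
    (hb : b 0 ∈ G.submodule) :
    pts (rightPlane b τ ![0, 1, -1]) =
      {X | X ∈ pts (bose K (mLine φ G)) ∧ IsIIColon φ s X} := by
  ext X
  obtain ⟨v, hv, rfl⟩ := exists_mk X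
  have hv1 : s v ≠ 0 := by simpa using hv
  have hv2 : s (s v) ≠ 0 := by simpa using hv
  rw [mk_mem_pts, mem_rightPlane, Set.mem_ofPred_eq, mk_mem_pts]
  change _ ↔ v ∈ mLine φ G ∧ _
  rw [mem_mLine hs hφ hb, IsIIColon, act_mk, act_mk]
  constructor
  · rintro ⟨x, rfl⟩
    have hx : x ≠ 0 := by rintro rfl; simp at hv
    have hE : Projectivization.mk L _ hv ∈ setE φ G := by
      rw [setE_eq hs hτ hφ hb]
      exact ⟨x, hx, by simp [Projectivization.submodule_mk]⟩
    refine ⟨⟨_, _, by rw [seg_vec, zero_smul]⟩, ⟨_, hE.2, ?_⟩, ?_⟩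
    · rw [mk_mem_pts]
      change _ ∈ Submodule.span L _
      exact Submodule.mem_span_singleton_self _
    · simp only [hs.map_seg hτ]
      -- The rotations of (0,1,-1) all lie on the line w₀ + w₁ + w₂ = 0.
      refine collinear3_seg hx _ _ _
        (f := Fintype.linearCombination K fun _ : Fin 3 => (1 : K)) ?_ ?_ ?_ ?_
      · intro h
        simpa [Fintype.linearCombination_apply, Fin.sum_univ_three] using
          LinearMap.congr_fun h ![1, 0, 0]
      all_goals simp [Fintype.linearCombination_apply, Fin.sum_univ_three]
  · rintro ⟨⟨y, z, rfl⟩, ⟨P, hP, hvP⟩, hcol⟩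
    rw [mk_mem_pts] at hvP
    change _ ∈ P.submodule at hvP
    rw [eq_mk_of_mem hv hvP, typeII_mk_iff hs hφ hv] at hP
    obtain ⟨hy, hz⟩ := ne_zero_of_norm_add hP hv
    have hy1 : τ y ≠ 0 := by simpa using hy
    have hz1 : τ z ≠ 0 := by simpa using hz
    have hz2 : τ (τ z) ≠ 0 := by simpa using hz
    obtain ⟨p, q, r, hrel, hne⟩ := exists_relation_of_collinear3 hcol
    rw [hs.map_cv, hs.map_cv, smul_cv', smul_cv', smul_cv', cv_add, cv_add, cv_eq_zero] at hrel
    obtain ⟨e0, e1, e2⟩ := hrel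
    have inj : Function.Injective (algebraMap K L) := (algebraMap K L).injective
    simp only [map_zero, smul_zero, add_zero, zero_add] at e0 e1 e2
    have e0' : q • z + r • τ y = 0 := by
      apply τ.injective
      simpa using e0
    have e1' : p • τ y + r • z = 0 := by
      have := congrArg τ e1
      simpa [hτ.cube] using this
    simp only [Algebra.smul_def] at e0' e1' e2
    have h1 : q ^ 2 = p * r := by
      apply inj
      simp only [map_mul, map_pow]
      apply mul_right_cancel₀ hy1
      linear_combination algebraMap K L q * e2 - algebraMap K L p * e0'
    have h2 : p ^ 2 = q * r := by
      apply inj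
      simp only [map_mul, map_pow]
      apply mul_right_cancel₀ hy1
      linear_combination algebraMap K L p * e1' - algebraMap K L r * e2
    have hpq : p = q := by
      apply hτ.cube_bij.1
      simp only
      linear_combination p * h2 - q * h1
    subst hpq
    have hp : p ≠ 0 := by
      rintro rfl
      have : r ≠ 0 := by simpa using hne
      have hr : algebraMap K L r * z = 0 := by simpa using e1'
      exact (mul_ne_zero (by simpa using this) hz) hr
    have hzy : z = -τ y := by
      have : algebraMap K L p * (z + τ y) = 0 := by linear_combination e2
      have := (mul_eq_zero.1 this).resolve_left (by simpa using hp)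
      linear_combination this
    refine ⟨τ (τ y), ?_⟩
    rw [seg_vec, hτ.cube, hzy]
    simp

theorem mk_mem_image_iff (hs : IsCyclicFrame b τ s) (hτ : IsCubicTwist τ) (hφ : Induces s φ)
    (S : Set (ℙ L V)) {v : V} (hv : v ≠ 0) (hv' : s (s v) ≠ 0) :
    Projectivization.mk L v hv ∈ φ '' S ↔ Projectivization.mk L (s (s v)) hv' ∈ S := by
  have h : φ (Projectivization.mk L (s (s v)) hv') = Projectivization.mk L v hv := by
    rw [hφ.apply_mk hv' (by simpa using hv)]
    simp only [hs.cube hτ]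
  rw [← h, φ.injective.mem_set_image]

theorem mk_mem_image_image_iff (hs : IsCyclicFrame b τ s) (hτ : IsCubicTwist τ)
    (hφ : Induces s φ) (S : Set (ℙ L V)) {v : V} (hv : v ≠ 0) (hv' : s v ≠ 0) :
    Projectivization.mk L v hv ∈ φ '' (φ '' S) ↔ Projectivization.mk L (s v) hv' ∈ S := by
  have h2 : s (s v) ≠ 0 := by simpa using hv
  rw [mk_mem_image_iff hs hτ hφ _ hv h2, mk_mem_image_iff hs hτ hφ _ h2 (by simpa using hv)]
  simp only [hs.cube hτ]

variable (b τ)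

/-- The point `ℓ^φ ∩ ℓ^(φ^2)` for the line `ℓ` with equation `m y + n z = 0`. -/
noncomputable def meetVec (m n : L) : V :=
  cv b (-(τ m * τ (τ n))) (τ m * τ (τ m)) (τ n * τ (τ n))

variable {b τ}

theorem meetVec_ne_zero {m n : L} (h : m ≠ 0 ∨ n ≠ 0) : meetVec b τ m n ≠ 0 := by
  rw [meetVec, ne_eq, cv_eq_zero]
  simp only [mul_eq_zero, EmbeddingLike.map_eq_zero_iff, or_self]
  tauto

/-- The vectors of `ℓ^φ ∩ ℓ^(φ^2)` are the multiples of `meetVec b τ m n`. -/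
theorem images_meet_iff (hs : IsCyclicFrame b τ s) (hτ : IsCubicTwist τ) {f : Module.Dual L V}
    (hf0 : f (b 0) = 0) (hf : f (b 1) ≠ 0 ∨ f (b 2) ≠ 0) (v : V) :
    (f (s (s v)) = 0 ∧ f (s v) = 0) ↔ ∃ c : L, c • meetVec b τ (f (b 1)) (f (b 2)) = v := by
  obtain ⟨x, y, z, rfl⟩ := exists_cv b v
  simp only [hs.map_cv, dual_cv, hf0, mul_zero, zero_add, meetVec, smul_cv, cv_inj]
  generalize f (b 1) = m at *
  generalize f (b 2) = n at *
  have h1 : τ (τ z) * m + τ (τ x) * n = 0 ↔ z * τ m + x * τ n = 0 := by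
    rw [← τ.map_eq_zero_iff]
    simp [hτ.cube]
  have h2 : τ x * m + τ y * n = 0 ↔ x * τ (τ m) + y * τ (τ n) = 0 := by
    rw [← τ.map_eq_zero_iff, ← τ.map_eq_zero_iff]
    simp [hτ.cube]
  rw [h1, h2]
  constructor
  · rintro ⟨e1, e2⟩
    by_cases hm : m = 0
    · subst hm
      have hn : n ≠ 0 := by simpa using hf
      have hn1 : τ n ≠ 0 := by simpa using hn
      have hn2 : τ (τ n) ≠ 0 := by simpa using hn
      have hx : x = 0 := by simpa [hn] using e1
      have hy : y = 0 := by simpa [hn] using e2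
      refine ⟨z / (τ n * τ (τ n)), by simp [hx], by simp [hy], by field_simp⟩
    · have hm1 : τ m ≠ 0 := by simpa using hm
      have hm2 : τ (τ m) ≠ 0 := by simpa using hm
      refine ⟨y / (τ m * τ (τ m)), ?_, by field_simp, ?_⟩
      · field_simp
        linear_combination -e2
      · field_simp
        linear_combination τ n * e2 - τ (τ m) * e1
  · rintro ⟨c, rfl, rfl, rfl⟩
    constructor <;> ring

/-- The two images of the line meet only in `meetVec`, and f takes the value N(m) + N(n) there. -/
theorem lineTypeIII_iff (hs : IsCyclicFrame b τ s) (hτ : IsCubicTwist τ) (hφ : Induces s φ)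
    {f : Module.Dual L V} (hf0 : f (b 0) = 0) (hf : f (b 1) ≠ 0 ∨ f (b 2) ≠ 0) :
    LineTypeIII φ (pts (LinearMap.ker f)) ↔
      f (b 1) * τ (f (b 1)) * τ (τ (f (b 1))) + f (b 2) * τ (f (b 2)) * τ (τ (f (b 2))) ≠ 0 := by
  have hV : Module.finrank L V = 3 := by rw [Module.finrank_eq_card_basis b]; simp
  have hfm : f (meetVec b τ (f (b 1)) (f (b 2))) =
      f (b 1) * τ (f (b 1)) * τ (τ (f (b 1))) + f (b 2) * τ (f (b 2)) * τ (τ (f (b 2))) := by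
    rw [meetVec, dual_cv, hf0]
    ring
  have hp := meetVec_ne_zero (b := b) (τ := τ) hf
  rw [← hfm]
  have hline : IsLine (pts (LinearMap.ker f)) := by
    refine (isLine_iff hV).2 ⟨f, ?_, rfl⟩
    rintro rfl
    simp at hf
  constructor
  · rintro ⟨-, h⟩ h0
    refine h ⟨Projectivization.mk L _ hp, mk_mem_pts.2 h0, ?_⟩
    rw [mk_mem_image_iff hs hτ hφ _ hp (by simpa using hp),
      mk_mem_image_image_iff hs hτ hφ _ hp (by simpa using hp), mk_mem_pts, mk_mem_pts]
    exact (images_meet_iff hs hτ hf0 hf _).2 ⟨1, one_smul _ _⟩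
  · refine fun h => ⟨hline, ?_⟩
    rintro ⟨P, h0, h1, h2⟩
    obtain ⟨v, hv, rfl⟩ := exists_mk P
    rw [mk_mem_image_iff hs hτ hφ _ hv (by simpa using hv), mk_mem_pts] at h1
    rw [mk_mem_image_image_iff hs hτ hφ _ hv (by simpa using hv), mk_mem_pts] at h2
    obtain ⟨c, rfl⟩ := (images_meet_iff hs hτ hf0 hf _).1 ⟨h1, h2⟩
    rw [mk_mem_pts, LinearMap.mem_ker, map_smul, smul_eq_mul] at h0
    have hc : c ≠ 0 := by rintro rfl; simp at hv
    exact (mul_ne_zero hc h) h0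

theorem images_inter_eq (hs : IsCyclicFrame b τ s) (hτ : IsCubicTwist τ) (hφ : Induces s φ)
    {f : Module.Dual L V} (hf0 : f (b 0) = 0) (hf : f (b 1) ≠ 0 ∨ f (b 2) ≠ 0) :
    φ '' pts (LinearMap.ker f) ∩ φ '' (φ '' pts (LinearMap.ker f)) =
      {Projectivization.mk L _ (meetVec_ne_zero (b := b) (τ := τ) hf)} := by
  ext P
  obtain ⟨v, hv, rfl⟩ := exists_mk P
  rw [Set.mem_inter_iff, mk_mem_image_iff hs hτ hφ _ hv (by simpa using hv),
    mk_mem_image_image_iff hs hτ hφ _ hv (by simpa using hv), mk_mem_pts, mk_mem_pts,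
    Set.mem_singleton_iff, Projectivization.mk_eq_mk_iff']
  exact images_meet_iff hs hτ hf0 hf v

theorem setF_iff (hs : IsCyclicFrame b τ s) (hτ : IsCubicTwist τ) (hφ : Induces s φ)
    (hb : b 0 ∈ G.submodule) {P : ℙ L V} :
    P ∈ setF φ G ↔ ∃ m n : L, m * τ m * τ (τ m) + n * τ n * τ (τ n) ≠ 0 ∧
      meetVec b τ m n ∈ P.submodule := by
  have hV : Module.finrank L V = 3 := by rw [Module.finrank_eq_card_basis b]; simp
  have hG := eq_mk_of_mem (b.ne_zero 0) hb
  constructor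
  · rintro ⟨ℓ, h3, hGℓ, hP⟩
    obtain ⟨f, hf, rfl⟩ := (isLine_iff hV).1 h3.1
    rw [hG, mk_mem_pts, LinearMap.mem_ker] at hGℓ
    have hf' : f (b 1) ≠ 0 ∨ f (b 2) ≠ 0 := by
      by_contra! h
      apply hf
      refine b.ext fun i => ?_
      fin_cases i
      exacts [hGℓ, h.1, h.2]
    refine ⟨f (b 1), f (b 2), (lineTypeIII_iff hs hτ hφ hGℓ hf').1 h3, ?_⟩
    rw [images_inter_eq hs hτ hφ hGℓ hf', Set.singleton_eq_singleton_iff] at hP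
    rw [← hP, Projectivization.submodule_mk]
    exact Submodule.mem_span_singleton_self _
  · rintro ⟨m, n, hN, hP⟩
    let f : Module.Dual L V := b.constr L ![0, m, n]
    have h0 : f (b 0) = 0 := by simp [f]
    have h1 : f (b 1) = m := by simp [f]
    have h2 : f (b 2) = n := by simp [f]
    have hf : f (b 1) ≠ 0 ∨ f (b 2) ≠ 0 := by
      rw [h1, h2]
      by_contra! h
      simp [h.1, h.2] at hN
    refine ⟨pts (LinearMap.ker f), (lineTypeIII_iff hs hτ hφ h0 hf).2 (by rwa [h1, h2]), ?_, ?_⟩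
    · rw [hG, mk_mem_pts]
      exact h0
    · rw [images_inter_eq hs hτ hφ h0 hf, Set.singleton_eq_singleton_iff]
      refine (eq_mk_of_mem _ ?_).symm
      rwa [h1, h2]

/-- The cases n = 0 and m = 0 give w = (0,1,0) and (0,0,1), the points G^φ and G^(φ²). Otherwise w =
(t, t², 1) with t³ = -N(m)/N(n), and t = 1 is just the excluded case N(m) + N(n) = 0. -/
theorem setF_eq (hs : IsCyclicFrame b τ s) (hτ : IsCubicTwist τ) (hφ : Induces s φ)
    (hb : b 0 ∈ G.submodule) :
    setF φ G = {P | ∃ (w : Fin 3 → K) (x : L), w ≠ 0 ∧ x ≠ 0 ∧ w 0 ^ 2 = w 1 * w 2 ∧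
      (¬ ∃ k : K, k ≠ 0 ∧ w = k • ![1, 1, 1]) ∧ seg b τ w x ∈ P.submodule} := by
  ext P
  rw [setF_iff hs hτ hφ hb]
  constructor
  · rintro ⟨m, n, hN, hP⟩
    by_cases hn : n = 0
    · subst hn
      have hm : m ≠ 0 := by rintro rfl; simp at hN
      refine ⟨![0, 1, 0], τ (τ (τ m * τ (τ m))), vec_one_ne, by simpa using hm, by simp, ?_, ?_⟩
      · rintro ⟨k, hk, h⟩
        exact hk (by simpa using (congrFun h 0).symm)
      · rw [seg_vec, hτ.cube]
        simpa [meetVec] using hP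
    by_cases hm : m = 0
    · subst hm
      refine ⟨![0, 0, 1], τ (τ n * τ (τ n)), vec_two_ne, by simpa using hn, by simp, ?_, ?_⟩
      · rintro ⟨k, hk, h⟩
        exact hk (by simpa using (congrFun h 0).symm)
      · rw [seg_vec, hτ.cube]
        simpa [meetVec] using hP
    have hm1 : τ m ≠ 0 := by simpa using hm
    have hm2 : τ (τ m) ≠ 0 := by simpa using hm
    have hn1 : τ n ≠ 0 := by simpa using hn
    have hn2 : τ (τ n) ≠ 0 := by simpa using hn
    obtain ⟨κ, hκ⟩ := hτ.fixed (-(m * τ m * τ (τ m)) / (n * τ n * τ (τ n))) (by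
      simp only [map_div₀, map_neg, map_mul, hτ.cube]
      field_simp)
    obtain ⟨t, rfl⟩ := hτ.cube_bij.2 κ
    simp only [map_pow] at hκ
    set T := algebraMap K L t with hT
    have hTτ : τ T = T := τ.commutes t
    have hT0 : T ≠ 0 := by
      intro h
      rw [h, eq_comm] at hκ
      simp [hm, hn] at hκ
    have hκ' : T ^ 3 * (n * τ n * τ (τ n)) = -(m * τ m * τ (τ m)) := by
      rw [hκ]; field_simp
    -- This is the ratio τ u / u forced by comparing the first two coordinates of `seg (t, t², 1) u`
    -- and `meetVec`. Its norm is 1 by the choice of t.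
    obtain ⟨u, hu, hu'⟩ := hτ.hilbert (-τ (τ m) / (τ (τ n) * T)) (by
      simp only [map_div₀, map_neg, map_mul, hτ.cube, hTτ]
      field_simp
      linear_combination -hκ')
    have hu'' : τ (τ u) = -(T * τ n) / τ m * u := by
      rw [hu', map_mul, hu']
      simp only [map_div₀, map_neg, map_mul, hτ.cube, hTτ]
      field_simp
      linear_combination hκ'
    refine ⟨![t, t ^ 2, 1], u, fun h => by simpa using congrFun h 2, hu, by simp, ?_, ?_⟩
    · rintro ⟨k, -, h⟩
      have h2 : k = 1 := by simpa using (congrFun h 2).symm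
      have h0 : t = 1 := by simpa [h2] using congrFun h 0
      rw [hT, h0, map_one] at hκ'
      exact hN (by linear_combination hκ')
    · have : seg b τ ![t, t ^ 2, 1] u = (-(T * u) / (τ m * τ (τ n))) • meetVec b τ m n := by
        rw [seg_vec, meetVec, smul_cv, cv_inj, hu'', hu']
        simp only [Algebra.smul_def, map_pow, map_one, ← hT]
        refine ⟨by field_simp, by field_simp, by field_simp⟩
      rw [this]
      exact Submodule.smul_mem _ _ hP
  · rintro ⟨w, x, hw, hx, hc, hone, hP⟩
    have hx1 : τ x ≠ 0 := by simpa using hx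
    have hx2 : τ (τ x) ≠ 0 := by simpa using hx
    by_cases h1 : w 1 = 0
    · have h0 : w 0 = 0 := by simpa [h1] using hc
      have h2 : w 2 ≠ 0 := fun h2 => hw (by ext i; fin_cases i <;> assumption)
      refine ⟨0, 1, by simp, ?_⟩
      have : meetVec b τ 0 1 = (w 2 • τ (τ x))⁻¹ • seg b τ w x := by
        rw [meetVec, seg_apply, smul_cv, cv_inj, h0, h1]
        refine ⟨by simp, by simp, ?_⟩
        rw [inv_mul_cancel₀ (smul_ne_zero h2 hx2)]
        simp
      rw [this]
      exact Submodule.smul_mem _ _ hP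
    · have hc' := congrArg (algebraMap K L) hc
      simp only [map_pow, map_mul] at hc'
      -- With this choice `meetVec` is w₁x times `seg w x`, and N(m) + N(n) = (w₁³ - w₀³)N(x).
      refine ⟨w 1 • τ (τ x), -(w 0 • τ x), ?_, ?_⟩
      · simp only [map_smul, map_neg, hτ.cube]
        simp only [Algebra.smul_def]
        intro h
        have hprod : (algebraMap K L (w 1) ^ 3 - algebraMap K L (w 0) ^ 3) *
            (x * τ x * τ (τ x)) = 0 := by linear_combination h
        have h3 := (mul_eq_zero.1 hprod).resolve_right
          (mul_ne_zero (mul_ne_zero hx hx1) hx2)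
        have h10 : w 1 = w 0 := by
          apply hτ.cube_bij.1
          apply (algebraMap K L).injective
          simp only [map_pow]
          linear_combination h3
        have h12 : w 1 = w 2 := by
          rw [← h10, pow_two] at hc
          exact mul_left_cancel₀ h1 hc
        refine hone ⟨w 1, h1, ?_⟩
        ext i
        fin_cases i
        · simp [h10]
        · simp
        · simp [h12]
      · have : meetVec b τ (w 1 • τ (τ x)) (-(w 0 • τ x)) = (w 1 • x) • seg b τ w x := by
          rw [meetVec, seg_apply, smul_cv, cv_inj]
          simp only [map_smul, map_neg, hτ.cube]
          simp only [Algebra.smul_def]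
          refine ⟨by ring, trivial, ?_⟩
          linear_combination (τ (τ x) * x) * hc'
        rw [this]
        exact Submodule.smul_mem _ _ hP

/-- Distinct points `seg b τ w x` with `w₁` and `w₂` nonzero lie in distinct spread planes. -/
theorem exists_smul_seg_eq (hτ : IsCubicTwist τ) {w w' : Fin 3 → K} {x x' c : L} (hx : x ≠ 0)
    (hx' : x' ≠ 0) (h1 : w 1 ≠ 0) (h2 : w 2 ≠ 0) (h1' : w' 1 ≠ 0) (h2' : w' 2 ≠ 0)
    (h : c • seg b τ w x = seg b τ w' x') : ∃ k : K, k • seg b τ w x = seg b τ w' x' := by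
  have h' := h
  rw [seg_apply, seg_apply, smul_cv, cv_inj] at h'
  obtain ⟨-, e1, e2⟩ := h'
  simp only [Algebra.smul_def] at e1 e2
  have a1 : algebraMap K L (w 1) ≠ 0 := by simpa using h1
  have a2 : algebraMap K L (w 2) ≠ 0 := by simpa using h2
  have a1' : algebraMap K L (w' 1) ≠ 0 := by simpa using h1'
  have a2' : algebraMap K L (w' 2) ≠ 0 := by simpa using h2'
  obtain ⟨k, hk⟩ : ∃ k : L, x' = k * x := ⟨x' / x, by field_simp⟩
  subst hk
  have hk : k ≠ 0 := left_ne_zero_of_mul hx'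
  have hk1 : τ k ≠ 0 := by simpa using hk
  have hk2 : τ (τ k) ≠ 0 := by simpa using hk
  have hx1 : τ x ≠ 0 := by simpa using hx
  have hx2 : τ (τ x) ≠ 0 := by simpa using hx
  simp only [map_mul] at e1 e2
  have f1 : c * algebraMap K L (w 1) = algebraMap K L (w' 1) * τ k := by
    apply mul_right_cancel₀ hx1
    linear_combination e1
  have f2 : c * algebraMap K L (w 2) = algebraMap K L (w' 2) * τ (τ k) := by
    apply mul_right_cancel₀ hx2
    linear_combination e2
  -- Only the last two coordinates are compared, so w₀ = 0 (the plane β) is allowed. They give τ²k =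
  -- μ τ k; going once around the cycle gives μ³ = 1, so μ = 1 and k lies in `K`.
  let μ : K := w' 1 * w 2 / (w 1 * w' 2)
  have hμ : τ (τ k) = algebraMap K L μ * τ k := by
    simp only [μ, map_div₀, map_mul]
    field_simp
    linear_combination algebraMap K L (w 2) * f1 - algebraMap K L (w 1) * f2
  have hμ' : k = algebraMap K L μ * τ (τ k) := by
    have := congrArg τ hμ
    rwa [hτ.cube, map_mul, τ.commutes] at this
  have hμ'' : τ k = algebraMap K L μ * k := by
    have := congrArg τ hμ'
    rwa [map_mul, hτ.cube, τ.commutes] at this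
  have hμ3 : μ ^ 3 = 1 := by
    apply (algebraMap K L).injective
    apply mul_right_cancel₀ hk
    rw [map_pow, map_one, one_mul]
    conv_rhs => rw [hμ', hμ, hμ'']
    ring
  have hμ1 : μ = 1 := hτ.cube_bij.1 (by simpa using hμ3)
  rw [hμ1, map_one, one_mul] at hμ''
  obtain ⟨κ, hκ⟩ := hτ.fixed k hμ''
  refine ⟨w' 1 / w 1 * κ, ?_⟩
  have hc : c = algebraMap K L (w' 1 / w 1 * κ) := by
    rw [map_mul, map_div₀, hκ]
    field_simp
    rw [hμ''] at f1
    linear_combination f1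
  rw [← algebraMap_smul L (w' 1 / w 1 * κ), ← hc, h]

end Blocks

/-! ### The claims about G, given a cyclic frame at G. -/

section BlockOfFrame

variable {K L V : Type*} [Field K] [Field L] [Algebra K L] [AddCommGroup V] [Module K V]
  [Module L V] [IsScalarTower K L V] {b : Module.Basis (Fin 3) L V} {τ : L ≃ₐ[K] L}
  {s : V ≃ₗ[K] V} {φ : Equiv.Perm (ℙ L V)} {G : ℙ L V}

theorem mem_B {T : Set (ℙ K V)} {P : ℙ L V} :
    P ∈ B L T ↔ ∃ v, ∃ hv : v ≠ 0, Projectivization.mk K v hv ∈ T ∧ v ∈ P.submodule := by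
  constructor
  · rintro ⟨X, hX, hXP⟩
    obtain ⟨v, hv, rfl⟩ := exists_mk X
    exact ⟨v, hv, hX, (mk_mem_pts (W := bose K P.submodule)).1 hXP⟩
  · rintro ⟨v, hv, hX, hP⟩
    exact ⟨_, hX, mk_mem_pts.2 hP⟩

theorem B_union (S T : Set (ℙ K V)) : B L (S ∪ T) = B L S ∪ B L T := by
  ext P
  simp only [B, Set.mem_ofPred_eq, Set.mem_union, Set.union_inter_distrib_right,
    Set.union_nonempty]

theorem mk_mem_pts_rightPlane {w : Fin 3 → K} {v : V} {hv : v ≠ 0} :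
    Projectivization.mk K v hv ∈ pts (rightPlane b τ w) ↔ ∃ x, x ≠ 0 ∧ seg b τ w x = v := by
  rw [mk_mem_pts, mem_rightPlane]
  apply exists_congr
  intro x
  refine ⟨fun h => ⟨?_, h⟩, fun h => h.2⟩
  rintro rfl
  exact hv (by rw [← h, map_zero])

theorem mk_mem_cover_scroll {v : V} {hv : v ≠ 0} :
    Projectivization.mk K v hv ∈ cover (scroll b τ) \ pts (rightPlane b τ ![1, 1, 1]) ↔
      ∃ (w : Fin 3 → K) (x : L), w ≠ 0 ∧ x ≠ 0 ∧ w 0 ^ 2 = w 1 * w 2 ∧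
        (¬ ∃ k : K, k ≠ 0 ∧ w = k • ![1, 1, 1]) ∧ seg b τ w x = v := by
  constructor
  · rintro ⟨⟨_, ⟨w, hw, hc, rfl⟩, hX⟩, hfix⟩
    obtain ⟨x, hx, rfl⟩ := mk_mem_pts_rightPlane.1 hX
    rw [mk_mem_pts, seg_mem_rightPlane hw hx] at hfix
    exact ⟨w, x, hw, hx, hc, hfix, rfl⟩
  · rintro ⟨w, x, hw, hx, hc, hfix, rfl⟩
    refine ⟨⟨_, ⟨w, hw, hc, rfl⟩, mk_mem_pts.2 ⟨x, rfl⟩⟩, ?_⟩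
    rwa [mk_mem_pts, seg_mem_rightPlane hw hx]

theorem vec_beta_ne : (![0, 1, -1] : Fin 3 → K) ≠ 0 := fun h => by simpa using congrFun h 1

theorem B_beta (hs : IsCyclicFrame b τ s) (hτ : IsCubicTwist τ) (hφ : Induces s φ)
    (hb : b 0 ∈ G.submodule) : B L (pts (rightPlane b τ (![0, 1, -1] : Fin 3 → K))) = setE φ G := by
  ext P
  rw [setE_eq hs hτ hφ hb, mem_B]
  simp only [mk_mem_pts_rightPlane]
  constructor
  · rintro ⟨_, -, ⟨x, hx, rfl⟩, hP⟩
    exact ⟨x, hx, hP⟩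
  · rintro ⟨x, hx, hP⟩
    exact ⟨_, seg_ne_zero vec_beta_ne hx, ⟨x, hx, rfl⟩, hP⟩

theorem B_scroll (hs : IsCyclicFrame b τ s) (hτ : IsCubicTwist τ) (hφ : Induces s φ)
    (hb : b 0 ∈ G.submodule) :
    B L (cover (scroll b τ) \ pts (rightPlane b τ ![1, 1, 1])) = setF φ G := by
  ext P
  rw [setF_eq hs hτ hφ hb, mem_B]
  simp only [mk_mem_cover_scroll]
  constructor
  · rintro ⟨_, -, ⟨w, x, hw, hx, hc, hfix, rfl⟩, hP⟩
    exact ⟨w, x, hw, hx, hc, hfix, hP⟩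
  · rintro ⟨w, x, hw, hx, hc, hfix, hP⟩
    exact ⟨_, seg_ne_zero hw hx, ⟨w, x, hw, hx, hc, hfix, rfl⟩, hP⟩

/-- On the conic, w₁ = 0 or w₂ = 0 forces w₀ = 0, which puts the point in the spread plane of G^(φ²)
or G^φ. Away from these two, `exists_smul_seg_eq` applies to β and the scroll together. -/
theorem existsUnique_point (hs : IsCyclicFrame b τ s) (hτ : IsCubicTwist τ) (hφ : Induces s φ)
    (hb : b 0 ∈ G.submodule) {Q : ℙ L V} (hQ : Q ∈ figBlock φ G) (h1 : Q ≠ φ G)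
    (h2 : Q ≠ φ (φ G)) :
    ∃! X : ℙ K V, X ∈ pts (rightPlane b τ ![0, 1, -1]) ∪
        (cover (scroll b τ) \ pts (rightPlane b τ ![1, 1, 1])) ∧
      X ∈ pts (bose K Q.submodule) := by
  have shape : ∀ X : ℙ K V, X ∈ pts (rightPlane b τ ![0, 1, -1]) ∪
      (cover (scroll b τ) \ pts (rightPlane b τ ![1, 1, 1])) → X ∈ pts (bose K Q.submodule) →
      ∃ (w : Fin 3 → K) (x : L) (h : seg b τ w x ≠ 0), x ≠ 0 ∧ w 1 ≠ 0 ∧ w 2 ≠ 0 ∧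
        seg b τ w x ∈ Q.submodule ∧ X = Projectivization.mk K _ h := by
    intro X hX hXQ
    obtain ⟨v, hv, rfl⟩ := exists_mk X
    rw [mk_mem_pts] at hXQ
    change v ∈ Q.submodule at hXQ
    rcases hX with hX | hX
    · obtain ⟨x, hx, rfl⟩ := mk_mem_pts_rightPlane.1 hX
      exact ⟨_, x, hv, hx, by simp, by simp, hXQ, rfl⟩
    · obtain ⟨w, x, hw, hx, hc, -, rfl⟩ := mk_mem_cover_scroll.1 hX
      refine ⟨w, x, hv, hx, ?_, ?_, hXQ, rfl⟩
      · intro hw1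
        have hw0 : w 0 = 0 := by simpa [hw1] using hc
        apply h2
        rw [hs.apply_apply_eq hφ hb, eq_mk_of_mem hv hXQ, Projectivization.mk_eq_mk_iff']
        refine ⟨w 2 • τ (τ x), ?_⟩
        rw [seg_apply, hw0, hw1]
        simp [cv]
      · intro hw2
        have hw0 : w 0 = 0 := by simpa [hw2] using hc
        apply h1
        rw [hs.apply_eq hφ hb, eq_mk_of_mem hv hXQ, Projectivization.mk_eq_mk_iff']
        refine ⟨w 1 • τ x, ?_⟩
        rw [seg_apply, hw0, hw2]
        simp [cv]
  have hB : Q ∈ B L (pts (rightPlane b τ (![0, 1, -1] : Fin 3 → K)) ∪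
      (cover (scroll b τ) \ pts (rightPlane b τ ![1, 1, 1]))) := by
    rw [B_union, B_beta hs hτ hφ hb, B_scroll hs hτ hφ hb]
    exact hQ
  obtain ⟨X, hX, hXQ⟩ := hB
  refine ⟨X, ⟨hX, hXQ⟩, ?_⟩
  rintro Y ⟨hY, hYQ⟩
  obtain ⟨w, x, h, hx, hw1, hw2, hQx, rfl⟩ := shape X hX hXQ
  obtain ⟨w', x', h', hx', hw1', hw2', hQx', rfl⟩ := shape Y hY hYQ
  rw [submodule_eq_span h hQx, Submodule.mem_span_singleton] at hQx'
  obtain ⟨c, hc⟩ := hQx'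
  rw [Projectivization.mk_eq_mk_iff']
  exact exists_smul_seg_eq hτ hx hx' hw1 hw2 hw1' hw2' hc

theorem block_of_frame [Finite K] (hL : Module.finrank K L = 3) (hs : IsCyclicFrame b τ s)
    (hτ : IsCubicTwist τ) (hφ : Induces s φ) (hG : TypeIII φ G) (hb : b 0 ∈ G.submodule)
    {πfix : Submodule K V} (hfix : πfix = rightPlane b τ ![1, 1, 1]) :
    ∃ G' : Set (Submodule K V), AreSegreRulings (setG φ s G) G' ∧
      (∀ H : Set (Submodule K V), AreSegreRulings (setG φ s G) H → H = G') ∧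
    ∃ β ∈ G', pts β = {X | X ∈ pts (bose K (mLine φ G)) ∧ IsIIColon φ s X} ∧
      B L (pts β) = setE φ G ∧
    ∀ P ∈ pts (bose K G.submodule),
      orbitSpan s P ∈ setG φ s G ∧
      ∃ A ∈ pts (orbitSpan s P), act s A = A ∧
        (∀ X ∈ pts (orbitSpan s P), act s X = X → X = A) ∧
      ∃ C : Set (ℙ K V), IsSpecifiedConic s P A C ∧
        (∀ C' : Set (ℙ K V), IsSpecifiedConic s P A C' → C' = C) ∧
      (planesMeeting G' C).ncard = Nat.card K + 1 ∧
      IsNormalRationalScroll (planesMeeting G' C) ∧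
      B L (cover (planesMeeting G' C) \ pts πfix) = setF φ G ∧
      figBlock φ G = B L (pts β ∪ (cover (planesMeeting G' C) \ pts πfix)) ∧
      ∀ Q ∈ figBlock φ G, Q ≠ φ G → Q ≠ φ (φ G) →
        ∃! X : ℙ K V, X ∈ pts β ∪ (cover (planesMeeting G' C) \ pts πfix) ∧
          X ∈ pts (bose K Q.submodule) := by
  subst hfix
  have hsegre := areSegreRulings_planes b τ hL
  rw [← hs.setG_eq hτ hG hb] at hsegre
  refine ⟨_, hsegre, fun H hH => hH.right_unique hsegre, rightPlane b τ ![0, 1, -1],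
    ⟨_, vec_beta_ne, rfl⟩, pts_beta hs hτ hφ hb, B_beta hs hτ hφ hb, fun P hP => ?_⟩
  obtain ⟨v, hv, rfl⟩ := exists_mk P
  rw [mk_mem_pts] at hP
  change v ∈ G.submodule at hP
  rw [submodule_eq_span (b.ne_zero 0) hb, Submodule.mem_span_singleton] at hP
  obtain ⟨x, hxv⟩ := hP
  have hx : x ≠ 0 := by rintro rfl; exact hv (by rw [← hxv, zero_smul])
  have hv' : v = seg b τ ![1, 0, 0] x := by rw [← hxv, ← cv_eq_seg]; simp [cv]
  subst hv'
  rw [hs.orbitSpan_eq hτ hx]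
  refine ⟨?_, Projectivization.mk K _ (seg_ne_zero vec_ones_ne hx), mk_mem_pts.2 ⟨_, rfl⟩,
    hs.act_ones hτ _, ?_, conicSet b τ x, isSpecifiedConic_conicSet hs hτ hx,
    fun C' => eq_conicSet_of_isSpecifiedConic hs hτ hx, ?_⟩
  · rw [hs.setG_eq hτ hG hb]
    exact ⟨x, hx, rfl⟩
  · intro X hX hfix
    obtain ⟨u, hu, rfl⟩ := exists_mk X
    rw [mk_mem_pts] at hX
    obtain ⟨y, rfl⟩ := hs.eq_ones_of_act_eq hτ hu hfix
    obtain ⟨w, hw⟩ := mem_leftPlane.1 hX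
    have hy : y ≠ 0 := by rintro rfl; simp at hu
    obtain ⟨k, -, -, hk⟩ := seg_eq_seg vec_ones_ne hy hw.symm
    rw [eq_comm, Projectivization.mk_eq_mk_iff']
    exact ⟨k, by rw [hk, map_smul]⟩
  rw [planesMeeting_conicSet hx]
  refine ⟨ncard_scroll, ⟨_, _, hsegre, ?_, ncard_scroll, ?_⟩, B_scroll hs hτ hφ hb, ?_,
    fun Q => existsUnique_point hs hτ hφ hb⟩
  · rintro _ ⟨w, hw, -, rfl⟩
    exact ⟨w, hw, rfl⟩
  · rw [hs.setG_eq hτ hG hb]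
    rintro _ ⟨y, hy, rfl⟩
    rw [cover_scroll_inter hy]
    exact isNondegConic_conicSet hτ.cube hy
  · rw [B_union, B_beta hs hτ hφ hb, B_scroll hs hτ hφ hb]
    rfl

end BlockOfFrame

/-! ### Normalizing a projectivity that induces φ. -/

section Scalar

variable {K L V : Type*} [Field K] [Field L] [Algebra K L] [AddCommGroup V] [Module K V]
  [Module L V] [IsScalarTower K L V] {s s' : V ≃ₗ[K] V} {φ : Equiv.Perm (ℙ L V)}

/-- This and `map_eq_of_smul` allow `s` to be replaced by a `K`-multiple of order 3 in every notion
of the theorem. -/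
theorem act_eq_of_smul {k : K} (h : ∀ v, s v = k • s' v) : act s = act s' := by
  funext X
  obtain ⟨v, hv, rfl⟩ := exists_mk X
  rw [act_mk, act_mk, Projectivization.mk_eq_mk_iff']
  exact ⟨k, (h v).symm⟩

theorem map_eq_of_smul {k : K} (hk : k ≠ 0) (h : ∀ v, s v = k • s' v) (W : Submodule K V) :
    W.map s.toLinearMap = W.map s'.toLinearMap := by
  ext v
  simp only [Submodule.mem_map, LinearEquiv.coe_coe, h]
  constructor
  · rintro ⟨u, hu, rfl⟩
    exact ⟨k • u, W.smul_mem k hu, by simp⟩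
  · rintro ⟨u, hu, rfl⟩
    exact ⟨k⁻¹ • u, W.smul_mem _ hu, by simp [smul_smul, hk]⟩

theorem setG_eq_of_act_eq (hact : act s = act s')
    (hmap : ∀ W : Submodule K V, W.map s.toLinearMap = W.map s'.toLinearMap) (G : ℙ L V) :
    setG φ s G = setG φ s' G := by
  simp only [setG, IsFixedIIIPlane, IsIIITriangle, hact, hmap]

theorem induces_of_semilinear {τ : L ≃ₐ[K] L} (hs : ∀ (c : L) (v : V), s (c • v) = τ c • s v)
    (h : ∀ (P : ℙ L V) (v : V), v ∈ P.submodule → s v ∈ (φ P).submodule) : Induces s φ := by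
  intro P
  obtain ⟨v, hv, rfl⟩ := exists_mk P
  have hmem := h (Projectivization.mk L v hv) v (by
    rw [Projectivization.submodule_mk]
    exact Submodule.mem_span_singleton_self _)
  have hspan := submodule_eq_span (by simpa using hv) hmem
  ext u
  change _ ↔ u ∈ (φ _).submodule
  simp only [hspan, Projectivization.submodule_mk, bose, Submodule.mem_map,
    Submodule.restrictScalars_mem, Submodule.mem_span_singleton]
  constructor
  · rintro ⟨_, ⟨c, rfl⟩, rfl⟩
    exact ⟨τ c, (hs c v).symm⟩
  · rintro ⟨c, rfl⟩
    exact ⟨_, ⟨τ.symm c, rfl⟩, by simp [hs]⟩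

/-- An additive map that fixes all points is a scalar multiplication. -/
theorem exists_eq_smul (b : Module.Basis (Fin 3) L V) (g : V →+ V)
    (hg : ∀ v, ∃ c : L, g v = c • v) : ∃ μ : L, ∀ v, g v = μ • v := by
  obtain ⟨μ, hμ⟩ := hg (cv b 1 1 1)
  have add : ∀ x y z : L, g (cv b x y z) = g (cv b x 0 0) + g (cv b 0 y 0) + g (cv b 0 0 z) := by
    intro x y z
    rw [← map_add, ← map_add, cv_add, cv_add]
    simp
  have h0 : ∀ x : L, ∃ c, g (cv b x 0 0) = cv b c 0 0 := fun x => by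
    obtain ⟨c, hc⟩ := hg (cv b x 0 0)
    exact ⟨_, by rw [hc, smul_cv, mul_zero]⟩
  have h1 : ∀ y : L, ∃ c, g (cv b 0 y 0) = cv b 0 c 0 := fun y => by
    obtain ⟨c, hc⟩ := hg (cv b 0 y 0)
    exact ⟨_, by rw [hc, smul_cv, mul_zero]⟩
  have h2 : ∀ z : L, ∃ c, g (cv b 0 0 z) = cv b 0 0 c := fun z => by
    obtain ⟨c, hc⟩ := hg (cv b 0 0 z)
    exact ⟨_, by rw [hc, smul_cv, mul_zero]⟩
  choose f0 h0 using h0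
  choose f1 h1 using h1
  choose f2 h2 using h2
  have all : ∀ x y z : L, ∃ c, f0 x = c * x ∧ f1 y = c * y ∧ f2 z = c * z := by
    intro x y z
    obtain ⟨c, hc⟩ := hg (cv b x y z)
    rw [add, h0, h1, h2, cv_add, cv_add, smul_cv, cv_inj] at hc
    exact ⟨c, by simpa using hc⟩
  rw [add, h0, h1, h2, cv_add, cv_add, smul_cv, cv_inj] at hμ
  simp only [add_zero, zero_add, mul_one] at hμ
  obtain ⟨m0, m1, m2⟩ := hμ
  -- A vector with a coordinate 1 elsewhere shares its scalar with (1,1,1).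
  have k0 : ∀ x, f0 x = μ * x := fun x => by
    obtain ⟨c, c0, c1, -⟩ := all x 1 1
    rw [c0, ← m1, c1, mul_one]
  have k1 : ∀ y, f1 y = μ * y := fun y => by
    obtain ⟨c, c0, c1, -⟩ := all 1 y 1
    rw [c1, ← m0, c0, mul_one]
  have k2 : ∀ z, f2 z = μ * z := fun z => by
    obtain ⟨c, c0, -, c2⟩ := all 1 1 z
    rw [c2, ← m0, c0, mul_one]
  refine ⟨μ, fun v => ?_⟩
  obtain ⟨x, y, z, rfl⟩ := exists_cv b v
  rw [add, h0, h1, h2, cv_add, cv_add, smul_cv, k0, k1, k2]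
  simp

/-- A projectivity inducing the same collineation as a `τ`-semilinear map of order 3 is, up to a
scalar of `K`, given by such a map. -/
theorem exists_cube_eq_one {τ : L ≃ₐ[K] L} (hτ : IsCubicTwist τ) (b : Module.Basis (Fin 3) L V)
    {t : V ≃ₗ[K] V} (ht : ∀ (c : L) (v : V), t (c • v) = τ c • t v) (ht3 : ∀ v, t (t (t v)) = v)
    (hφt : Induces t φ) (hφ : Induces s φ) :
    ∃ (k : K) (s' : V ≃ₗ[K] V), k ≠ 0 ∧ (∀ v, s v = k • s' v) ∧
      (∀ (c : L) (v : V), s' (c • v) = τ c • s' v) ∧ ∀ v, s' (s' (s' v)) = v := by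
  have hpt : ∀ v, ∃ c : L, s (t.symm v) = c • v := by
    intro v
    by_cases hv : v = 0
    · exact ⟨0, by simp [hv]⟩
    have h0 : t.symm v ≠ 0 := by simpa using hv
    have h1 := hφ.apply_mk h0 (by simpa using hv)
    rw [hφt.apply_mk h0 (by simpa using hv), eq_comm, Projectivization.mk_eq_mk_iff'] at h1
    obtain ⟨c, hc⟩ := h1
    exact ⟨c, by rw [← hc, LinearEquiv.apply_symm_apply]⟩
  obtain ⟨μ, hμ⟩ := exists_eq_smul b (s.toLinearMap ∘ₗ t.symm.toLinearMap).toAddMonoidHom hpt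
  have hst : ∀ v, s v = μ • t v := by
    intro v
    have := hμ (t v)
    simpa using this
  have hμ0 : μ ≠ 0 := by
    rintro rfl
    have : s (b 0) ≠ 0 := by simpa using b.ne_zero 0
    exact this (by rw [hst, zero_smul])
  -- The cube of μt is multiplication by N(μ), so dividing by a cube root k of N(μ) in `K` gives
  -- order 3.
  obtain ⟨κ, hκ⟩ := hτ.fixed (μ * τ μ * τ (τ μ)) (by
    simp only [map_mul, hτ.cube]
    ring)
  obtain ⟨k, rfl⟩ := hτ.cube_bij.2 κ
  simp only [map_pow] at hκ
  have hk : k ≠ 0 := by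
    rintro rfl
    rw [map_zero, eq_comm] at hκ
    simp [hμ0] at hκ
  have hk' : algebraMap K L k ≠ 0 := by simpa using hk
  have hval : ∀ v, (s.trans (LinearEquiv.smulOfUnit (Units.mk0 k⁻¹ (inv_ne_zero hk)))) v =
      ((algebraMap K L k)⁻¹ * μ) • t v := by
    intro v
    change k⁻¹ • s v = _
    rw [hst, mul_smul, ← map_inv₀, algebraMap_smul]
  refine ⟨k, s.trans (LinearEquiv.smulOfUnit (Units.mk0 k⁻¹ (inv_ne_zero hk))), hk, ?_, ?_, ?_⟩
  · intro v
    change s v = k • k⁻¹ • s v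
    rw [smul_inv_smul₀ hk]
  · intro c v
    rw [hval, hval, ht, smul_comm]
  · intro v
    rw [hval, hval, hval, ht, ht, ht, ht3, smul_smul, smul_smul]
    simp only [map_mul, map_inv₀, AlgEquiv.commutes]
    convert one_smul L v
    field_simp
    linear_combination -hκ

end Scalar

/-! ### The semilinear form of φ, a Type III point, and cyclic frames. -/

section Existence

variable {K L V : Type*} [Field K] [Field L] [Algebra K L] [AddCommGroup V] [Module K V]
  [Module L V] [IsScalarTower K L V] {s : V ≃ₗ[K] V} {φ : Equiv.Perm (ℙ L V)} {τ : L ≃ₐ[K] L}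

/-- An element of `PΓL` fixing an `F_q`-plane pointwise acts on coordinates by an automorphism. -/
theorem exists_semilinear [Finite K] (hL : Module.finrank K L = 3)
    (hφ : IsCollineation φ) (hφ3 : orderOf φ = 3)
    (hfix : ∃ S : Set (ℙ L V), IsFqPlane K S ∧ ∀ P ∈ S, φ P = P) :
    ∃ (τ : L ≃ₐ[K] L) (t : V ≃ₗ[K] V) (b : Module.Basis (Fin 3) L V), τ ≠ 1 ∧
      (∀ (c : L) (v : V), t (c • v) = τ c • t v) ∧ (∀ v, t (t (t v)) = v) ∧ Induces t φ ∧
      ∀ i, t (b i) = b i := by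
  obtain ⟨σ, f, hf, hfP⟩ := hφ
  obtain ⟨S, ⟨b, rfl⟩, hS⟩ := hfix
  have fixed : ∀ c : Fin 3 → K, c ≠ 0 → ∃ ν : L, f (∑ i, c i • b i) = ν • ∑ i, c i • b i := by
    intro c hc
    have hv : ∑ i, c i • b i ≠ 0 := by
      intro h0
      have hL' : ∑ i, algebraMap K L (c i) • b i = 0 := by
        simpa only [algebraMap_smul] using h0
      have := Fintype.linearIndependent_iff.1 b.linearIndependent _ hL'
      exact hc (funext fun i => by simpa using this i)
    have hm : ∑ i, c i • b i ∈ (Projectivization.mk L _ hv).submodule := by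
      rw [Projectivization.submodule_mk]
      exact Submodule.mem_span_singleton_self _
    have := hfP _ _ hm
    rw [hS _ ⟨c, hc, hm⟩, Projectivization.submodule_mk, Submodule.mem_span_singleton] at this
    obtain ⟨ν, hν⟩ := this
    exact ⟨ν, hν.symm⟩
  have fixed' : ∀ p q r : K, ![p, q, r] ≠ 0 → ∃ ν : L,
      f (cv b (algebraMap K L p) (algebraMap K L q) (algebraMap K L r)) =
        ν • cv b (algebraMap K L p) (algebraMap K L q) (algebraMap K L r) := by
    intro p q r h
    obtain ⟨ν, hν⟩ := fixed _ h
    refine ⟨ν, ?_⟩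
    simpa [Fin.sum_univ_three, cv] using hν
  -- Fixing the four points of the standard frame makes f a scalar ν times a coordinatewise
  -- automorphism.
  obtain ⟨ν, hν⟩ := fixed' 1 1 1 vec_ones_ne
  obtain ⟨ν0, h0⟩ := fixed' 1 0 0 vec_zero_ne
  obtain ⟨ν1, h1⟩ := fixed' 0 1 0 vec_one_ne
  obtain ⟨ν2, h2⟩ := fixed' 0 0 1 vec_two_ne
  simp only [map_one, map_zero, cv_basis_zero, cv_basis_one, cv_basis_two] at hν h0 h1 h2
  have hcv : ∀ x y z, f (cv b x y z) = cv b (σ x * ν0) (σ y * ν1) (σ z * ν2) := by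
    intro x y z
    simp only [cv, map_add, hf, h0, h1, h2, smul_smul]
  rw [hcv, smul_cv, cv_inj] at hν
  simp only [map_one, one_mul, mul_one] at hν
  obtain ⟨e0, e1, e2⟩ := hν
  rw [e0] at h0
  simp only [e0, e1, e2] at hcv
  have hν' : ν ≠ 0 := by
    rintro rfl
    rw [zero_smul, map_eq_zero_iff f f.injective] at h0
    exact b.ne_zero 0 h0
  -- The fixed points (1, k, 0) force the automorphism to be trivial on `K`.
  have hσK : ∀ k : K, σ (algebraMap K L k) = algebraMap K L k := by
    intro k
    obtain ⟨ν', h'⟩ := fixed' 1 k 0 (fun h => by simpa using congrFun h 0)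
    rw [hcv, smul_cv, cv_inj] at h'
    obtain ⟨e0, e1, -⟩ := h'
    simp only [map_one, one_mul, mul_one] at e0
    rw [← e0, mul_comm] at e1
    exact mul_left_cancel₀ hν' e1
  let τ : L ≃ₐ[K] L := AlgEquiv.ofRingEquiv (f := σ) hσK
  have hτσ : ∀ x, τ x = σ x := fun x => rfl
  have hcube : ∀ x, τ (τ (τ x)) = x := cube_of_finrank hL τ
  let t₀ : V →ₗ[K] V :=
    { toFun := fun v => ν⁻¹ • f v
      map_add' := fun u v => by rw [map_add, smul_add]
      map_smul' := fun k v => by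
        rw [← algebraMap_smul L k v, hf, hσK, smul_comm, algebraMap_smul, RingHom.id_apply] }
  have ht₀ : ∀ v, t₀ v = ν⁻¹ • f v := fun v => rfl
  have ht₀cv : ∀ x y z, t₀ (cv b x y z) = cv b (τ x) (τ y) (τ z) := by
    intro x y z
    rw [ht₀, hcv, smul_cv, cv_inj]
    simp only [hτσ]
    refine ⟨?_, ?_, ?_⟩ <;> field_simp
  have ht₀3 : ∀ v, t₀ (t₀ (t₀ v)) = v := by
    intro v
    obtain ⟨x, y, z, rfl⟩ := exists_cv b v
    simp only [ht₀cv, hcube]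
  let t : V ≃ₗ[K] V := LinearEquiv.ofLinearMap t₀ (t₀ ∘ₗ t₀) (LinearMap.ext ht₀3)
    (LinearMap.ext ht₀3)
  have hsemi : ∀ (c : L) (v : V), t (c • v) = τ c • t v := by
    intro c v
    change ν⁻¹ • f (c • v) = σ c • ν⁻¹ • f v
    rw [hf, smul_comm]
  have hpt : ∀ (P : ℙ L V) (v : V), v ∈ P.submodule → t v ∈ (φ P).submodule :=
    fun P v hv => Submodule.smul_mem _ _ (hfP P v hv)
  refine ⟨τ, t, b, ?_, hsemi, ht₀3, induces_of_semilinear hsemi hpt, ?_⟩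
  · intro hτ1
    have hid : φ = 1 := by
      ext P
      obtain ⟨v, hv, rfl⟩ := exists_mk P
      have htv : t v = v := by
        obtain ⟨x, y, z, rfl⟩ := exists_cv b v
        change t₀ _ = _
        rw [ht₀cv, hτ1]
        rfl
      have := hpt (Projectivization.mk L v hv) v (by
        rw [Projectivization.submodule_mk]
        exact Submodule.mem_span_singleton_self _)
      rw [htv] at this
      exact eq_mk_of_mem hv this
    rw [hid, orderOf_one] at hφ3
    omega
  · intro i
    change t₀ (b i) = b i
    fin_cases i
    · change t₀ (b 0) = b 0
      rw [← cv_basis_zero, ht₀cv]; simp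
    · change t₀ (b 1) = b 1
      rw [← cv_basis_one, ht₀cv]; simp
    · change t₀ (b 2) = b 2
      rw [← cv_basis_two, ht₀cv]; simp

/-- The point (1, a, a²) with a not fixed by τ works: its orbit has the Vandermonde determinant of
three distinct conjugates. -/
theorem exists_typeIII (hV : Module.finrank L V = 3) (hτ1 : τ ≠ 1)
    (hcube : ∀ x, τ (τ (τ x)) = x) {t : V ≃ₗ[K] V}
    (ht : ∀ (c : L) (v : V), t (c • v) = τ c • t v) (hφ : Induces t φ)
    {b : Module.Basis (Fin 3) L V} (hb : ∀ i, t (b i) = b i) : ∃ G, TypeIII φ G := by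
  obtain ⟨a, ha⟩ : ∃ a, τ a ≠ a := by
    by_contra! h
    exact hτ1 (AlgEquiv.ext h)
  have ha1 : τ (τ a) ≠ τ a := fun h => ha (τ.injective h)
  have ha2 : τ (τ a) ≠ a := fun h => ha (by
    have := congrArg τ h
    rw [hcube] at this
    exact this.symm)
  have hcv : ∀ x y z, t (cv b x y z) = cv b (τ x) (τ y) (τ z) := by
    intro x y z
    simp only [cv, map_add, ht, hb]
  have hv : cv b 1 a (a ^ 2) ≠ 0 := by simp [cv_eq_zero]
  have hv1 : t (cv b 1 a (a ^ 2)) ≠ 0 := by simpa using hv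
  have hv2 : t (t (cv b 1 a (a ^ 2))) ≠ 0 := by simpa using hv
  refine ⟨Projectivization.mk L _ hv, ?_⟩
  rw [TypeIII, hφ.apply_mk hv hv1, hφ.apply_mk hv1 hv2, collinear3_mk_iff hV]
  rintro ⟨f, hf, e0, e1, e2⟩
  simp only [hcv, dual_cv, map_one, map_pow, one_mul] at e0 e1 e2
  have d1 : f (b 1) + (a + τ a) * f (b 2) = 0 := by
    apply mul_left_cancel₀ (sub_ne_zero.2 ha)
    linear_combination e1 - e0
  have d2 : f (b 1) + (a + τ (τ a)) * f (b 2) = 0 := by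
    apply mul_left_cancel₀ (sub_ne_zero.2 ha2)
    linear_combination e2 - e0
  have f2 : f (b 2) = 0 := by
    apply mul_left_cancel₀ (sub_ne_zero.2 ha1)
    linear_combination d2 - d1
  have f1 : f (b 1) = 0 := by simpa [f2] using d1
  have f0 : f (b 0) = 0 := by simpa [f1, f2] using e0
  apply hf
  refine b.ext fun i => ?_
  fin_cases i
  exacts [f0, f1, f2]

/-- Type III says precisely that v, s v, s² v span V, and s³ = 1 closes the cycle. -/
theorem exists_frame (hV : Module.finrank L V = 3) (hs : ∀ (c : L) (v : V), s (c • v) = τ c • s v)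
    (hs3 : ∀ v, s (s (s v)) = v) (hφ : Induces s φ) {G : ℙ L V} (hG : TypeIII φ G) :
    ∃ b : Module.Basis (Fin 3) L V, IsCyclicFrame b τ s ∧ b 0 ∈ G.submodule := by
  obtain ⟨v, hv, rfl⟩ := exists_mk G
  have hv1 : s v ≠ 0 := by simpa using hv
  have hv2 : s (s v) ≠ 0 := by simpa using hv
  rw [TypeIII, hφ.apply_mk hv hv1, hφ.apply_mk hv1 hv2, collinear3_mk_iff hV] at hG
  have hspan : ⊤ ≤ Submodule.span L (Set.range ![v, s v, s (s v)]) := by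
    by_contra hlt
    obtain ⟨f, hf, hle⟩ := Submodule.exists_le_ker_of_lt_top _
      (lt_top_iff_ne_top.2 fun h => hlt h.ge)
    exact hG ⟨f, hf, hle (Submodule.subset_span ⟨0, rfl⟩), hle (Submodule.subset_span ⟨1, rfl⟩),
      hle (Submodule.subset_span ⟨2, rfl⟩)⟩
  let b := basisOfTopLeSpanOfCardEqFinrank ![v, s v, s (s v)] hspan (by rw [hV]; simp)
  have hb : ⇑b = ![v, s v, s (s v)] := coe_basisOfTopLeSpanOfCardEqFinrank _ _ _
  refine ⟨b, ⟨fun x y z => ?_⟩, ?_⟩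
  · simp only [cv, hb, map_add, hs]
    simp only [Matrix.cons_val, hs3]
    abel
  · rw [hb, Projectivization.submodule_mk]
    exact Submodule.mem_span_singleton_self _

end Existence

end Figueroa

/-! ### The theorem. -/

open Figueroa in
theorem theorem27 {K L V : Type*} [Field K] [Finite K] [Field L] [Algebra K L]
    [AddCommGroup V] [Module K V] [Module L V] [IsScalarTower K L V]
    (hL : Module.finrank K L = 3) (hV : Module.finrank L V = 3)
    (hq2 : 2 < Nat.card K) (hq : ¬ Nat.card K ≡ 1 [MOD 3])
    (φ : Equiv.Perm (ℙ L V)) (hφ : IsCollineation φ) (hφ3 : orderOf φ = 3)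
    (hfix : ∃ S : Set (ℙ L V), IsFqPlane K S ∧ ∀ P ∈ S, φ P = P) :
    (∃ s : V ≃ₗ[K] V, Induces s φ) ∧
    ∀ s : V ≃ₗ[K] V, Induces s φ →
    -- the unique pointwise fixed plane
    ∃ πfix : Submodule K V, IsPtwiseFixedPlane s πfix ∧
      (∀ π : Submodule K V, IsPtwiseFixedPlane s π → π = πfix) ∧
    ∀ G : ℙ L V, TypeIII φ G →
    -- the set of fixed-III-planes meeting `⟦G⟧` is a ruling system; `G'` is the other one
    ∃ G' : Set (Submodule K V), AreSegreRulings (setG φ s G) G' ∧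
      (∀ H : Set (Submodule K V), AreSegreRulings (setG φ s G) H → H = G') ∧
    -- the plane `β`
    ∃ β ∈ G', pts β = {X | X ∈ pts (bose K (mLine φ G)) ∧ IsIIColon φ s X} ∧
      B L (pts β) = setE φ G ∧
    ∀ P ∈ pts (bose K G.submodule),
      orbitSpan s P ∈ setG φ s G ∧
      -- the unique fixed point `A` of the plane
      ∃ A ∈ pts (orbitSpan s P), act s A = A ∧
        (∀ X ∈ pts (orbitSpan s P), act s X = X → X = A) ∧
      -- the unique conic `C`
      ∃ C : Set (ℙ K V), IsSpecifiedConic s P A C ∧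
        (∀ C' : Set (ℙ K V), IsSpecifiedConic s P A C' → C' = C) ∧
      -- the scroll
      (planesMeeting G' C).ncard = Nat.card K + 1 ∧
      IsNormalRationalScroll (planesMeeting G' C) ∧
      B L (cover (planesMeeting G' C) \ pts πfix) = setF φ G ∧
      -- the Figueroa block
      figBlock φ G = B L (pts β ∪ (cover (planesMeeting G' C) \ pts πfix)) ∧
      ∀ Q ∈ figBlock φ G, Q ≠ φ G → Q ≠ φ (φ G) →
        ∃! X : ℙ K V, X ∈ pts β ∪ (cover (planesMeeting G' C) \ pts πfix) ∧
          X ∈ pts (bose K Q.submodule) := by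
  obtain ⟨τ, t, b, hτ1, ht, ht3, hφt, hb⟩ := exists_semilinear hL hφ hφ3 hfix
  have hτ := isCubicTwist_of_ne_one hL hq hτ1
  refine ⟨⟨t, hφt⟩, fun s hφs => ?_⟩
  obtain ⟨k, s', hk, hss', hs', hs'3⟩ := exists_cube_eq_one hτ b ht ht3 hφt hφs
  have hact := act_eq_of_smul hss'
  have hmap := map_eq_of_smul hk hss'
  have hφs' : Induces s' φ := fun P => by rw [← hmap, hφs P]
  simp only [IsPtwiseFixedPlane, IsIIColon, IsSpecifiedConic, orbitSpan, hact,
    setG_eq_of_act_eq hact hmap]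
  -- The fixed plane must be named before any G is given, so some Type III point is needed to supply
  -- a frame.
  obtain ⟨G₀, hG₀⟩ := exists_typeIII hV hτ1 hτ.cube ht hφt hb
  obtain ⟨b₀, hb₀, -⟩ := exists_frame hV hs' hs'3 hφs' hG₀
  refine ⟨rightPlane b₀ τ ![1, 1, 1], hb₀.isPtwiseFixedPlane_ones hτ hL,
    fun π hπ => hb₀.eq_of_isPtwiseFixedPlane hτ hL hπ, fun G hG => ?_⟩
  obtain ⟨b₁, hb₁, hbG⟩ := exists_frame hV hs' hs'3 hφs' hG
  -- Uniqueness of the fixed plane identifies the one from the frame at G₀ with the one from the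
  -- frame at G.
  exact block_of_frame hL hb₁ hτ hφs' hG hbG
    (hb₁.eq_of_isPtwiseFixedPlane hτ hL (hb₀.isPtwiseFixedPlane_ones hτ hL))
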